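/- Let $\mathcal C$ be a left cancellative small category, i.e. a small category whose arrows satisfy $xy=xz\Rightarrow y=z$ whenever $xy$ and $xz$ are defined; we write $\mathcal C$ also for its set of arrows, $\mathbf s(c)$ for the source of $c$ (an object, identified with its identity arrow), and $ab$ for "first $b$, then $a$". Let $\mathcal I(\mathcal C)$ be the symmetric inverse monoid of all partial bijections of the set $\mathcal C$, and identify its idempotents with the subsets of $\mathcal C$ (their domains). Let $\mathcal I_l\subseteq\mathcal I(\mathcal C)$ be the inverse subsemigroup generated by the left multiplication maps $\mathbf s(c)\mathcal C\to c\,\mathcal C$, $x\mapsto cx$ (also denoted $c$), for $c\in\mathcal C$, and let $E$ be the semilattice of idempotents of $\mathcal I_l$. Let $\Omega$ be the space, with the topology of pointwise convergence, of all nonzero maps $\chi:E\to\{0,1\}$ with $\chi(ef)=\chi(e)\chi(f)$ for all $e,f\in E$ and $\chi(f)=\bigvee_{i=1}^n\chi(e_i)$ whenever $n\ge 0$, $f,e_1,\dots,e_n\in E$ and $f=\bigcup_{i=1}^n e_i$ as subsets of $\mathcal C$ (so $\chi(\emptyset)=0$ if $\emptyset\in E$). Let $\overline E$ be the set of subsets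 of $\mathcal C$ of the form $\bigcup_{i=1}^n\bigl(e_i\setminus\bigcup_{j=1}^{k_i}f_{ij}\bigr)$ with $e_i,f_{ij}\in E$ and $f_{ij}\subseteq e_i$. Each $\chi\in\Omega$ extends to $\overline E$ by $\chi\bigl(\bigcup_i(e_i\setminus\bigcup_j f_{ij})\bigr)=\bigvee_i\bigl(\chi(e_i)\setminus\bigvee_j\chi(f_{ij})\bigr)$, computed in the Boolean algebra $\{0,1\}$. Let $\overline{\mathcal I}_l=\{se : s\in\mathcal I_l,\ e\in\overline E,\ e\le s^{-1}s\}$, an inverse semigroup. An element $s\in\overline{\mathcal I}_l$ acts on $\{\chi\in\Omega : \chi(s^{-1}s)=1\}$ by $(s\cdot\chi)(e)=\chi(s^{-1}es)$. Let $\mathcal G=\overline{\mathcal I}_l\ltimes\Omega$ be the groupoid of germs $[s,\chi]$ with $s\in\overline{\mathcal I}_l$, $\chi\in\Omega$, $\chi(s^{-1}s)=1$, where $[s,\chi]=[t,\psi]$ if and only if $\chi=\psi$ and $se=te$ for some idempotent $e\in\overline{\mathcal I}_l$ with $\chi(e)=1$. Its unit space is $\Omega$, the source and target of $[s,\chi]$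 are $\chi$ and $s\cdot\chi$, the product is $[s,t\cdot\chi][t,\chi]=[st,\chi]$, the inverse is $[s,\chi]^{-1}=[s^{-1},s\cdot\chi]$, and the sets $[s,U]=\{[s,\chi]:\chi\in U\}$, for $s\in\overline{\mathcal I}_l$ and $U\subseteq\{\chi\in\Omega:\chi(s^{-1}s)=1\}$ open, form a basis of its topology. Finally, let $\mathcal C^*$ be the set of invertible arrows of $\mathcal C$ and $\mathcal C^*\ltimes\Omega=\{[u,\chi]\in\mathcal G : u\in\mathcal C^*,\ \chi(u^{-1}u)=1\}$. Then $\mathcal G$ is an étale groupoid (a topological groupoid with locally compact Hausdorff unit space whose source and target maps are local homeomorphisms), $\mathcal C^*\ltimes\Omega$ is an open subgroupoid of $\mathcal G$, and $\mathcal G$ is topologically principal relative to $\mathcal C^*\ltimes\Omega$; that is, the set of all $x\in\Omega$ for which there is an open bisection $\Gamma\subseteq\mathcal G$ (an open set on which source and target restrict to homeomorphisms onto their images) with $x\in\Gamma^{-1}\Gamma$ and $\Gamma\,\mathcal G_x^x\,\Gamma^{-1}\subseteq\mathcal C^*\ltimes\Omega$ is dense in $\Omega$, where $\mathcal G_x^x$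 is the isotropy group at $x$. -/

import Mathlib

open CategoryTheory Topology

universe u v

/-! ## Topological groupoids, given by their arrows -/

/-- A groupoid with set of arrows `G` and set of units `X`: source, target, unit arrows,
inversion, and a product `mul a b` defined exactly when the source of `a` is the target of `b`. -/
class ArrowGroupoid (G : Type*) (X : outParam Type*) where
  src : G → X
  tgt : G → X
  unit : X → G
  inv : G → G
  mul : ∀ a b : G, src a = tgt b → G
  src_unit : ∀ x, src (unit x) = x
  tgt_unit : ∀ x, tgt (unit x) = x
  src_inv : ∀ a, src (inv a) = tgt a
  tgt_inv : ∀ a, tgt (inv a) = src a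
  src_mul : ∀ a b h, src (mul a b h) = src b
  tgt_mul : ∀ a b h, tgt (mul a b h) = tgt a
  mul_assoc : ∀ (a b c : G) (h : src a = tgt b) (k : src b = tgt c),
    mul (mul a b h) c ((src_mul a b h).trans k) = mul a (mul b c k) (h.trans (tgt_mul b c k).symm)
  unit_mul : ∀ a, mul (unit (tgt a)) a (src_unit (tgt a)) = a
  mul_unit : ∀ a, mul a (unit (src a)) (tgt_unit (src a)).symm = a
  inv_mul : ∀ a, mul (inv a) a (src_inv a) = unit (src a)
  mul_inv : ∀ a, mul a (inv a) (tgt_inv a).symm = unit (tgt a)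

namespace ArrowGroupoid

variable (G : Type*) {X : Type*} [ArrowGroupoid G X]

/-- An étale groupoid: a topological groupoid (all structure maps are continuous) with locally
compact Hausdorff unit space whose source and target maps are local homeomorphisms.
(Since `src ∘ unit = id`, the map `unit` is then a homeomorphism of `X` onto the set of unit
arrows with the relative topology.) -/
structure IsEtale [TopologicalSpace G] [TopologicalSpace X] : Prop where
  t2 : T2Space X
  locallyCompact : LocallyCompactSpace X
  continuous_unit : Continuous (unit : X → G)
  continuous_inv : Continuous (inv : G → G)
  continuous_mul : Continuous fun p : {p : G × G // src p.1 = tgt p.2} => mul p.1.1 p.1.2 p.2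
  src_local_homeo : IsLocalHomeomorph (src : G → X)
  tgt_local_homeo : IsLocalHomeomorph (tgt : G → X)

variable {G}

/-- The product `A B` of two sets of arrows. -/
def setMul (A B : Set G) : Set G := {g | ∃ a ∈ A, ∃ b ∈ B, ∃ h : src a = tgt b, g = mul a b h}

/-- The inverse `A⁻¹` of a set of arrows. -/
def setInv (A : Set G) : Set G := {g | ∃ a ∈ A, g = inv a}

variable (G) in
/-- The isotropy group at the unit `x`, as a set of arrows. -/
def isotropy (x : X) : Set G := {g | src g = x ∧ tgt g = x}

/-- A subset of the arrows that is a subgroupoid and open. -/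
structure IsOpenSubgroupoid [TopologicalSpace G] (H : Set G) : Prop where
  inv_mem : ∀ a ∈ H, inv a ∈ H
  mul_mem : ∀ a ∈ H, ∀ b ∈ H, ∀ h : src a = tgt b, mul a b h ∈ H
  isOpen : IsOpen H

/-- Open bisections: open sets of arrows on which source and target restrict to homeomorphisms
onto their images. -/
structure IsOpenBisection [TopologicalSpace G] [TopologicalSpace X] (A : Set G) : Prop where
  isOpen : IsOpen A
  src_embedding : IsEmbedding (A.domRestrict (src : G → X))
  tgt_embedding : IsEmbedding (A.domRestrict (tgt : G → X))

/-- The set of units `x` for which there are an open bisection `Γ` and a member `H` of the family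
such that `x ∈ Γ⁻¹ Γ` and `Γ Gₓˣ Γ⁻¹ ⊆ H`. -/
def constrainedUnits [TopologicalSpace G] [TopologicalSpace X] (𝓗 : Set (Set G)) : Set X :=
  {x | ∃ Γ : Set G, IsOpenBisection Γ ∧ ∃ H ∈ 𝓗, unit x ∈ setMul (setInv Γ) Γ ∧
    setMul (setMul Γ (isotropy G x)) (setInv Γ) ⊆ H}

/-- `G` is topologically principal relative to the family `𝓗` (of open subgroupoids). -/
def IsTopPrincipalRelTo [TopologicalSpace G] [TopologicalSpace X] (𝓗 : Set (Set G)) : Prop :=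
  Dense (constrainedUnits 𝓗)

end ArrowGroupoid

/-! ## Partial bijections of a set -/

namespace PartialBij

variable {A : Type*}

open Classical in
/-- The idempotent partial bijection with domain `D`. -/
noncomputable def idOn (D : Set A) : A ≃. A := PEquiv.ofSet D

/-- The product `s t` in the symmetric inverse monoid: first `t`, then `s`. -/
def comp (s t : A ≃. A) : A ≃. A := t.trans s

/-- The domain of `s`, that is, the idempotent `s⁻¹ s`. -/
def dom (s : A ≃. A) : Set A := {x | ∃ y, s x = some y}

/-- The set corresponding to the idempotent `s⁻¹ D s`. -/
def conj (s : A ≃. A) (D : Set A) : Set A := {x | ∃ y, s x = some y ∧ y ∈ D}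

theorem idOn_apply {D : Set A} {x y : A} : idOn D x = some y ↔ y = x ∧ x ∈ D := by
  unfold idOn
  rw [PEquiv.ofSet_eq_some_iff]
  constructor
  · rintro ⟨rfl, h⟩; exact ⟨rfl, h⟩
  · rintro ⟨rfl, h⟩; exact ⟨rfl, h⟩

theorem comp_apply {s t : A ≃. A} {x z : A} :
    comp s t x = some z ↔ ∃ y, t x = some y ∧ s y = some z := PEquiv.trans_eq_some _ _ _ _

theorem ext_some {s t : A ≃. A} (h : ∀ x y, s x = some y ↔ t x = some y) : s = t :=
  PEquiv.ext fun x => Option.ext fun y => h x y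

theorem comp_assoc (r s t : A ≃. A) : comp (comp r s) t = comp r (comp s t) :=
  (PEquiv.trans_assoc _ _ _).symm

theorem comp_idOn_eq_iff {D : Set A} {s t : A ≃. A} :
    comp s (idOn D) = comp t (idOn D) ↔ ∀ x ∈ D, s x = t x := by
  constructor
  · intro h x hx
    apply Option.ext
    intro y
    have := congrArg (fun f : A ≃. A => f x = some y) h
    simp only [eq_iff_iff, comp_apply, idOn_apply] at this
    simpa [hx] using this
  · intro h
    apply ext_some
    intro x y
    simp only [comp_apply, idOn_apply]
    constructor
    · rintro ⟨z, ⟨rfl, hx⟩, h'⟩; exact ⟨z, ⟨rfl, hx⟩, by rw [← h z hx]; exact h'⟩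
    · rintro ⟨z, ⟨rfl, hx⟩, h'⟩; exact ⟨z, ⟨rfl, hx⟩, by rw [h z hx]; exact h'⟩

theorem idOn_inter (D F : Set A) : comp (idOn D) (idOn F) = idOn (D ∩ F) := by
  apply ext_some
  intro x y
  simp only [comp_apply, idOn_apply, Set.mem_inter_iff]
  grind

theorem conj_idOn (s : A ≃. A) (D : Set A) :
    comp (comp s.symm (idOn D)) s = idOn (conj s D) := by
  apply ext_some
  intro x y
  simp only [comp_apply, idOn_apply, conj, Set.mem_ofPred_eq, PEquiv.eq_some_iff]
  constructor
  · rintro ⟨z, hz, w, ⟨rfl, hw⟩, h⟩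
    exact ⟨s.inj h hz, w, hz, hw⟩
  · rintro ⟨rfl, z, hz, hD⟩
    exact ⟨z, hz, z, ⟨rfl, hD⟩, hz⟩

theorem conj_inter (s : A ≃. A) (D F : Set A) : conj s (D ∩ F) = conj s D ∩ conj s F := by
  ext x; simp only [conj, Set.mem_ofPred_eq, Set.mem_inter_iff]; grind

theorem conj_diff (s : A ≃. A) (D F : Set A) : conj s (D \ F) = conj s D \ conj s F := by
  ext x; simp only [conj, Set.mem_ofPred_eq, Set.mem_sdiff]; grind

theorem conj_iUnion (s : A ≃. A) {ι : Sort*} (D : ι → Set A) :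
    conj s (⋃ i, D i) = ⋃ i, conj s (D i) := by
  ext x; simp only [conj, Set.mem_ofPred_eq, Set.mem_iUnion]; grind

theorem conj_mono (s : A ≃. A) {D F : Set A} (h : D ⊆ F) : conj s D ⊆ conj s F := by
  rintro x ⟨y, hy, hD⟩; exact ⟨y, hy, h hD⟩

theorem conj_comp (s t : A ≃. A) (D : Set A) : conj (comp s t) D = conj t (conj s D) := by
  ext x; simp only [conj, Set.mem_ofPred_eq, comp_apply]; grind

theorem dom_comp (s t : A ≃. A) : dom (comp s t) = conj t (dom s) := by
  ext x; simp only [conj, dom, Set.mem_ofPred_eq, comp_apply]; grind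

theorem conj_subset_dom (s : A ≃. A) (D : Set A) : conj s D ⊆ dom s := by
  rintro x ⟨y, hy, -⟩; exact ⟨y, hy⟩

theorem conj_dom_symm (s : A ≃. A) : conj s (dom s.symm) = dom s := by
  ext x; simp only [conj, dom, Set.mem_ofPred_eq, PEquiv.eq_some_iff]; grind

theorem dom_idOn (D : Set A) : dom (idOn D) = D := by
  ext x; simp [dom, idOn_apply]

theorem conj_idOn_set (D F : Set A) : conj (idOn D) F = D ∩ F := by
  ext x; simp [conj, idOn_apply]

theorem symm_comp_self (s : A ≃. A) : comp s.symm s = idOn (dom s) := by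
  apply ext_some
  intro x y
  simp only [comp_apply, idOn_apply, dom, Set.mem_ofPred_eq, PEquiv.eq_some_iff]
  constructor
  · rintro ⟨z, h, h'⟩; exact ⟨s.inj h' h, z, h⟩
  · rintro ⟨rfl, z, h⟩; exact ⟨z, h, h⟩

theorem comp_idOn_dom (s : A ≃. A) : comp s (idOn (dom s)) = s := by
  apply ext_some
  intro x y
  simp only [comp_apply, idOn_apply, dom, Set.mem_ofPred_eq]
  grind

theorem symm_comp (s t : A ≃. A) : (comp s t).symm = comp t.symm s.symm := rfl

theorem symm_idOn (D : Set A) : (idOn D).symm = idOn D := rfl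

end PartialBij

/-! ## Left cancellative small categories -/

namespace LCSC

open PartialBij

/-- Left cancellativity: `a b = a b'` implies `b = b'`, where `a b` means first `b`, then `a`. -/
class LeftCancellative (C : Type u) [Category.{v} C] : Prop where
  cancel : ∀ {x y z : C} (a : y ⟶ z) (b b' : x ⟶ y), b ≫ a = b' ≫ a → b = b'

/-- The set of all arrows of `C`. -/
structure Mor (C : Type u) [Category.{v} C] where
  src : C
  tgt : C
  hom : src ⟶ tgt

variable {C : Type u} [Category.{v} C]

open Classical in
/-- The partially defined product `c x` (first `x`, then `c`). -/
noncomputable def mulOpt (c x : Mor C) : Option (Mor C) :=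
  if h : x.tgt = c.src then some ⟨x.src, c.tgt, x.hom ≫ eqToHom h ≫ c.hom⟩ else none

variable [LeftCancellative C]

theorem mulOpt_inj {c x x' y : Mor C} (h : mulOpt c x = some y) (h' : mulOpt c x' = some y) :
    x = x' := by
  obtain ⟨cs, ct, c⟩ := c
  obtain ⟨xs, xt, x⟩ := x
  obtain ⟨xs', xt', x'⟩ := x'
  obtain ⟨ys, yt, y⟩ := y
  unfold mulOpt at h h'
  simp only at h h'
  split_ifs at h with h1
  split_ifs at h' with h2
  subst h1; subst h2
  simp only [eqToHom_refl, Category.id_comp, Option.some.injEq, Mor.mk.injEq] at h h'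
  obtain ⟨rfl, -, h⟩ := h
  obtain ⟨rfl, -, h'⟩ := h'
  have := LeftCancellative.cancel _ _ _ (eq_of_heq (h.trans h'.symm))
  rw [this]

open Classical in
/-- The left multiplication map `s(c) C → c C`, `x ↦ c x`, as a partial bijection of the set of
arrows. -/
noncomputable def leftMul (c : Mor C) : Mor C ≃. Mor C where
  toFun := mulOpt c
  invFun y := if h : ∃ x, mulOpt c x = some y then some h.choose else none
  inv x y := by
    constructor
    · intro h
      split_ifs at h with hx
      rw [Option.some.injEq] at h
      exact h ▸ hx.choose_spec
    · intro h
      have hx : ∃ x, mulOpt c x = some y := ⟨x, h⟩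
      rw [dif_pos hx, mulOpt_inj hx.choose_spec h]

variable (C) in
/-- The left inverse hull: the inverse semigroup of partial bijections generated by the left
multiplication maps. -/
inductive LeftInverseHull : (Mor C ≃. Mor C) → Prop
  | leftMul (c : Mor C) : LeftInverseHull (leftMul c)
  | symm (s : Mor C ≃. Mor C) : LeftInverseHull s → LeftInverseHull s.symm
  | comp (s t : Mor C ≃. Mor C) : LeftInverseHull s → LeftInverseHull t →
      LeftInverseHull (comp s t)

variable (C) in
/-- The semilattice of idempotents of the left inverse hull, identified with a family of subsets
of the set of arrows. -/
def Idem : Type max u v := {D : Set (Mor C) // LeftInverseHull C (idOn D)}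

instance : CoeOut (Idem C) (Set (Mor C)) := ⟨Subtype.val⟩

/-- The product of two idempotents is the intersection. -/
instance : Min (Idem C) :=
  ⟨fun e f => ⟨e.1 ∩ f.1, idOn_inter e.1 f.1 ▸ LeftInverseHull.comp _ _ e.2 f.2⟩⟩

variable (C) in
/-- The space `Ω`: the nonzero multiplicative maps from the semilattice of idempotents to `{0, 1}`
that preserve every finite union that exists in it. (For the empty union: the empty set, if it
is there, is sent to `0`.) -/
def Omega : Set (Idem C → Bool) :=
  {χ | (∃ e, χ e = true) ∧ (∀ e f, χ (e ⊓ f) = (χ e ⊓ χ f)) ∧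
    ∀ (n : ℕ) (e : Fin n → Idem C) (f : Idem C), (f : Set (Mor C)) = ⋃ i, (e i : Set (Mor C)) →
      χ f = Finset.univ.sup fun i => χ (e i)}

variable (C) in
/-- A Boolean expression `⋃ᵢ (eᵢ \ ⋃ⱼ fᵢⱼ)` in idempotents with `fᵢⱼ ≤ eᵢ`. -/
structure BoolExpr where
  n : ℕ
  e : Fin n → Idem C
  k : Fin n → ℕ
  f : ∀ i, Fin (k i) → Idem C
  le : ∀ i j, (f i j : Set (Mor C)) ⊆ e i

/-- The value of the expression in the subsets of `C`. -/
def BoolExpr.toSet (R : BoolExpr C) : Set (Mor C) :=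
  ⋃ i, ((R.e i : Set (Mor C)) \ ⋃ j, (R.f i j : Set (Mor C)))

/-- The value at a character of the expression in the Boolean algebra `{0, 1}`. -/
noncomputable def BoolExpr.eval (R : BoolExpr C) (χ : Idem C → Bool) : Bool :=
  Finset.univ.sup fun i => χ (R.e i) \ Finset.univ.sup fun j => χ (R.f i j)

variable (C) in
/-- The Boolean closure of the semilattice of idempotents. -/
def BoolClosure : Set (Set (Mor C)) := {D | ∃ R : BoolExpr C, R.toSet = D}

/-- The extension of a character to the Boolean closure: `Holds χ D` says that the extension takes
the value `1` at `D`. It is independent of the expression for `D` by `holds_toSet_iff` below. -/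
def Holds (χ : Omega C) (D : Set (Mor C)) : Prop :=
  ∃ R : BoolExpr C, R.toSet = D ∧ R.eval χ.1 = true

variable (C) in
/-- The enlarged left inverse hull: all restrictions `s D` of members `s` of the left inverse hull
to members `D` of the Boolean closure with `D ≤ s⁻¹ s`. -/
def HullBar : Set (Mor C ≃. Mor C) :=
  {r | ∃ s D, LeftInverseHull C s ∧ D ∈ BoolClosure C ∧ D ⊆ dom s ∧ r = comp s (idOn D)}

/-! ### Closure properties of the hulls -/

theorem idem_conj {s : Mor C ≃. Mor C} (hs : LeftInverseHull C s) (e : Idem C) :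
    LeftInverseHull C (idOn (conj s e.1)) := by
  rw [← conj_idOn]
  exact .comp _ _ (.comp _ _ (.symm _ hs) e.2) hs

theorem idem_dom {s : Mor C ≃. Mor C} (hs : LeftInverseHull C s) :
    LeftInverseHull C (idOn (dom s)) := by
  rw [← symm_comp_self]
  exact .comp _ _ (.symm _ hs) hs

theorem idem_mem_boolClosure (e : Idem C) : e.1 ∈ BoolClosure C :=
  ⟨⟨1, fun _ => e, fun _ => 0, fun _ j => j.elim0, fun _ j => j.elim0⟩, by
    ext x; simp [BoolExpr.toSet]⟩

theorem conj_mem_boolClosure_of_hull {s : Mor C ≃. Mor C} (hs : LeftInverseHull C s)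
    {D : Set (Mor C)} (hD : D ∈ BoolClosure C) : conj s D ∈ BoolClosure C := by
  obtain ⟨R, rfl⟩ := hD
  refine ⟨⟨R.n, fun i => ⟨_, idem_conj hs (R.e i)⟩, R.k, fun i j => ⟨_, idem_conj hs (R.f i j)⟩,
    fun i j => conj_mono s (R.le i j)⟩, ?_⟩
  simp only [BoolExpr.toSet, conj_iUnion, conj_diff]

theorem inter_idem_mem_boolClosure {D : Set (Mor C)} (hD : D ∈ BoolClosure C) (e : Idem C) :
    D ∩ e.1 ∈ BoolClosure C := by
  have := conj_mem_boolClosure_of_hull e.2 hD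
  rwa [conj_idOn_set, Set.inter_comm] at this

theorem inter_mem_boolClosure {D F : Set (Mor C)} (hD : D ∈ BoolClosure C)
    (hF : F ∈ BoolClosure C) : D ∩ F ∈ BoolClosure C := by
  obtain ⟨R, rfl⟩ := hD
  obtain ⟨S, rfl⟩ := hF
  let p : Fin (R.n * S.n) → Fin R.n × Fin S.n := finProdFinEquiv.symm
  refine ⟨⟨R.n * S.n, fun i => R.e (p i).1 ⊓ S.e (p i).2,
    fun i => R.k (p i).1 + S.k (p i).2,
    fun i => Fin.append (fun j => R.f (p i).1 j ⊓ S.e (p i).2)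
      (fun j => R.e (p i).1 ⊓ S.f (p i).2 j), ?_⟩, ?_⟩
  · intro i j
    refine Fin.addCases (fun j => ?_) (fun j => ?_) j
    · rw [Fin.append_left]; exact Set.inter_subset_inter_left _ (R.le _ _)
    · rw [Fin.append_right]; exact Set.inter_subset_inter_right _ (S.le _ _)
  · ext x
    simp only [BoolExpr.toSet, Set.mem_iUnion, Set.mem_sdiff, Set.mem_inter_iff]
    constructor
    · rintro ⟨i, ⟨h1, h2⟩, h⟩
      refine ⟨⟨(p i).1, h1, ?_⟩, ⟨(p i).2, h2, ?_⟩⟩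
      · rintro ⟨j, hj⟩
        exact h ⟨Fin.castAdd _ j, by rw [Fin.append_left]; exact ⟨hj, h2⟩⟩
      · rintro ⟨j, hj⟩
        exact h ⟨Fin.natAdd _ j, by rw [Fin.append_right]; exact ⟨h1, hj⟩⟩
    · rintro ⟨⟨a, h1, ha⟩, ⟨b, h2, hb⟩⟩
      refine ⟨finProdFinEquiv (a, b), ?_⟩
      have hp : p (finProdFinEquiv (a, b)) = (a, b) := Equiv.symm_apply_apply _ _
      rw [hp]
      refine ⟨⟨h1, h2⟩, ?_⟩
      rintro ⟨j, hj⟩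
      revert hj
      refine Fin.addCases (fun j => ?_) (fun j => ?_) j
      · rw [Fin.append_left]; intro hj; exact ha ⟨j, hj.1⟩
      · rw [Fin.append_right]; intro hj; exact hb ⟨j, hj.2⟩

/-- A restriction of a member of the hull, with a redundant part of the domain allowed. -/
theorem restrict_mem_hullBar {s : Mor C ≃. Mor C} (hs : LeftInverseHull C s) {D : Set (Mor C)}
    (hD : D ∈ BoolClosure C) : comp s (idOn D) ∈ HullBar C := by
  refine ⟨s, D ∩ dom s, hs, inter_idem_mem_boolClosure hD ⟨_, idem_dom hs⟩,
    Set.inter_subset_right, ?_⟩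
  rw [← idOn_inter, ← comp_assoc]
  apply ext_some
  intro x y
  simp only [comp_apply, idOn_apply, dom, Set.mem_ofPred_eq]
  grind

theorem mem_hullBar_of_hull {s : Mor C ≃. Mor C} (hs : LeftInverseHull C s) : s ∈ HullBar C :=
  ⟨s, dom s, hs, idem_mem_boolClosure ⟨_, idem_dom hs⟩, subset_rfl, (comp_idOn_dom s).symm⟩

theorem idOn_comp {A : Type*} (s : A ≃. A) (D : Set A) :
    comp (idOn D) s = comp s (idOn (conj s D)) := by
  apply ext_some
  intro x y
  simp only [comp_apply, idOn_apply, conj, Set.mem_ofPred_eq]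
  grind

theorem comp_mem_hullBar {s t : Mor C ≃. Mor C} (hs : s ∈ HullBar C) (ht : t ∈ HullBar C) :
    comp s t ∈ HullBar C := by
  obtain ⟨s, D, hs, hD, -, rfl⟩ := hs
  obtain ⟨t, F, ht, hF, -, rfl⟩ := ht
  have : comp (comp s (idOn D)) (comp t (idOn F)) =
      comp (comp s t) (idOn (conj t D ∩ F)) := by
    rw [comp_assoc, ← comp_assoc (idOn D), idOn_comp, comp_assoc t, idOn_inter, comp_assoc]
  rw [this]
  exact restrict_mem_hullBar (.comp _ _ hs ht)
    (inter_mem_boolClosure (conj_mem_boolClosure_of_hull ht hD) hF)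

theorem symm_mem_hullBar {s : Mor C ≃. Mor C} (hs : s ∈ HullBar C) : s.symm ∈ HullBar C := by
  obtain ⟨s, D, hs, hD, -, rfl⟩ := hs
  rw [symm_comp, symm_idOn, idOn_comp]
  exact restrict_mem_hullBar (.symm _ hs) (conj_mem_boolClosure_of_hull (.symm _ hs) hD)

theorem dom_mem_boolClosure {s : Mor C ≃. Mor C} (hs : s ∈ HullBar C) :
    dom s ∈ BoolClosure C := by
  obtain ⟨s, D, hs, hD, -, rfl⟩ := hs
  rw [dom_comp, conj_idOn_set]
  exact inter_idem_mem_boolClosure hD ⟨_, idem_dom hs⟩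

theorem conj_mem_boolClosure {s : Mor C ≃. Mor C} (hs : s ∈ HullBar C)
    {D : Set (Mor C)} (hD : D ∈ BoolClosure C) : conj s D ∈ BoolClosure C := by
  obtain ⟨s, F, hs, hF, -, rfl⟩ := hs
  rw [conj_comp, conj_idOn_set]
  exact inter_mem_boolClosure hF (conj_mem_boolClosure_of_hull hs hD)

theorem idOn_dom_mem {s : Mor C ≃. Mor C} (hs : s ∈ HullBar C) : idOn (dom s) ∈ HullBar C := by
  rw [← symm_comp_self]
  exact comp_mem_hullBar (symm_mem_hullBar hs) hs

theorem idOn_inter_mem {D F : Set (Mor C)} (hD : idOn D ∈ HullBar C) (hF : idOn F ∈ HullBar C) :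
    idOn (D ∩ F) ∈ HullBar C := by
  rw [← idOn_inter]
  exact comp_mem_hullBar hD hF

theorem idOn_conj_mem {s : Mor C ≃. Mor C} (hs : s ∈ HullBar C) {D : Set (Mor C)}
    (hD : idOn D ∈ HullBar C) : idOn (conj s D) ∈ HullBar C := by
  rw [← conj_idOn]
  exact comp_mem_hullBar (comp_mem_hullBar (symm_mem_hullBar hs) hD) hs

theorem mem_boolClosure_of_idOn {D : Set (Mor C)} (hD : idOn D ∈ HullBar C) :
    D ∈ BoolClosure C := by
  have := dom_mem_boolClosure hD
  rwa [dom_idOn] at this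

/-! ### The extension of a character is well defined -/

theorem char_mono (χ : Omega C) {e f : Idem C} (h : e.1 ⊆ f.1) (he : χ.1 e = true) :
    χ.1 f = true := by
  have h1 := χ.2.2.1 e f
  have h2 : e ⊓ f = e := Subtype.ext (Set.inter_eq_left.2 h)
  rw [h2, he] at h1
  simpa using h1.symm

theorem char_not_cover (χ : Omega C) {e : Idem C} (he : χ.1 e = true) {L : List (Idem C)}
    (hL : ∀ f ∈ L, χ.1 f = false) : ∃ x ∈ e.1, ∀ f ∈ L, x ∉ f.1 := by
  by_contra! hcon
  have h := χ.2.2.2 L.length (fun i => e ⊓ L.get i) e (by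
    ext x
    simp only [Set.mem_iUnion]
    constructor
    · intro hx
      obtain ⟨f, hf, hxf⟩ := hcon x hx
      obtain ⟨i, rfl⟩ := List.get_of_mem hf
      exact ⟨i, hx, hxf⟩
    · rintro ⟨i, hx, -⟩; exact hx)
  rw [he] at h
  have h0 : (Finset.univ.sup fun i => χ.1 (e ⊓ L.get i)) = (⊥ : Bool) := by
    rw [Finset.sup_eq_bot_iff]
    intro i _
    rw [χ.2.2.1, hL _ (List.get_mem L i)]
    simp
  rw [h0] at h
  simp at h

/-- The filter of subsets of the set of arrows attached to a character. -/
def charFilter (χ : Omega C) : Filter (Mor C) where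
  sets := {D | ∃ e, χ.1 e = true ∧ ∃ L : List (Idem C), (∀ f ∈ L, χ.1 f = false) ∧
    ∀ x ∈ e.1, (∀ f ∈ L, x ∉ f.1) → x ∈ D}
  univ_sets := by
    obtain ⟨e, he⟩ := χ.2.1
    exact ⟨e, he, [], by simp, by simp⟩
  sets_of_superset := by
    rintro D F ⟨e, he, L, hL, h⟩ hDF
    exact ⟨e, he, L, hL, fun x hx hxL => hDF (h x hx hxL)⟩
  inter_sets := by
    rintro D F ⟨e, he, L, hL, h⟩ ⟨e', he', L', hL', h'⟩
    refine ⟨e ⊓ e', by rw [χ.2.2.1, he, he']; rfl, L ++ L', ?_, ?_⟩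
    · intro f hf
      rcases List.mem_append.1 hf with hf | hf
      · exact hL f hf
      · exact hL' f hf
    · intro x hx hxL
      exact ⟨h x hx.1 fun f hf => hxL f (List.mem_append_left _ hf),
        h' x hx.2 fun f hf => hxL f (List.mem_append_right _ hf)⟩

instance charFilter_neBot (χ : Omega C) : (charFilter χ).NeBot := by
  constructor
  intro h
  have : (∅ : Set (Mor C)) ∈ charFilter χ := by rw [h]; trivial
  obtain ⟨e, he, L, hL, h⟩ := this
  obtain ⟨x, hx, hxL⟩ := char_not_cover χ he hL
  exact h x hx hxL

theorem idem_mem_charFilter {χ : Omega C} {e : Idem C} (h : χ.1 e = true) :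
    e.1 ∈ charFilter χ := ⟨e, h, [], by simp, fun _ hx _ => hx⟩

theorem idem_compl_mem_charFilter {χ : Omega C} {f : Idem C} (h : χ.1 f = false) :
    f.1ᶜ ∈ charFilter χ := by
  obtain ⟨e, he⟩ := χ.2.1
  exact ⟨e, he, [f], by simpa using h, fun x _ hx => by simpa using hx⟩

theorem not_mem_of_compl_mem {χ : Omega C} {D : Set (Mor C)} (h : Dᶜ ∈ charFilter χ) :
    D ∉ charFilter χ := fun h' => by
  have := Filter.inter_mem h' h
  rw [Set.inter_compl_self] at this
  exact Filter.empty_notMem _ this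

theorem mem_charFilter_iff_idem {χ : Omega C} {e : Idem C} :
    e.1 ∈ charFilter χ ↔ χ.1 e = true := by
  refine ⟨fun h => ?_, idem_mem_charFilter⟩
  by_contra hn
  exact not_mem_of_compl_mem (idem_compl_mem_charFilter (by simpa using hn)) h

theorem sup_eq_true {n : ℕ} {b : Fin n → Bool} :
    Finset.univ.sup b = true ↔ ∃ i, b i = true := by
  rw [← not_iff_not, not_exists, Bool.not_eq_true]
  change _ = (⊥ : Bool) ↔ _
  rw [Finset.sup_eq_bot_iff]
  simp

theorem eval_eq_true {R : BoolExpr C} {χ : Idem C → Bool} :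
    R.eval χ = true ↔ ∃ i, χ (R.e i) = true ∧ ∀ j, χ (R.f i j) = false := by
  have hs : ∀ a b : Bool, a \ b = true ↔ a = true ∧ b ≠ true := by decide
  unfold BoolExpr.eval
  rw [sup_eq_true]
  refine exists_congr fun i => ?_
  rw [hs, Ne, sup_eq_true]
  simp

theorem toSet_mem_of_eval {R : BoolExpr C} {χ : Omega C} (h : R.eval χ.1 = true) :
    R.toSet ∈ charFilter χ := by
  obtain ⟨i, hi, hj⟩ := eval_eq_true.1 h
  refine Filter.mem_of_superset (Filter.inter_mem (idem_mem_charFilter hi)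
    (Filter.iInter_mem.2 fun j => idem_compl_mem_charFilter (hj j))) ?_
  rintro x ⟨hx, hx'⟩
  refine Set.mem_iUnion.2 ⟨i, hx, ?_⟩
  simpa using hx'

theorem toSet_compl_mem_of_eval {R : BoolExpr C} {χ : Omega C} (h : ¬ R.eval χ.1 = true) :
    R.toSetᶜ ∈ charFilter χ := by
  rw [eval_eq_true] at h
  push Not at h
  have : ∀ i, ((R.e i : Set (Mor C)) \ ⋃ j, (R.f i j : Set (Mor C)))ᶜ ∈ charFilter χ := by
    intro i
    by_cases hi : χ.1 (R.e i) = true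
    · obtain ⟨j, hj⟩ := h i hi
      refine Filter.mem_of_superset (idem_mem_charFilter (e := R.f i j) (by simpa using hj)) ?_
      intro x hx hx'
      exact hx'.2 (Set.mem_iUnion.2 ⟨j, hx⟩)
    · refine Filter.mem_of_superset (idem_compl_mem_charFilter (f := R.e i) (by simpa using hi)) ?_
      intro x hx hx'
      exact hx hx'.1
  refine Filter.mem_of_superset (Filter.iInter_mem.2 this) ?_
  intro x hx hx'
  obtain ⟨i, hi⟩ := Set.mem_iUnion.1 hx'
  exact Set.mem_iInter.1 hx i hi

theorem eval_iff_mem_charFilter (χ : Omega C) (R : BoolExpr C) :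
    R.eval χ.1 = true ↔ R.toSet ∈ charFilter χ := by
  refine ⟨toSet_mem_of_eval, fun h => ?_⟩
  by_contra hn
  exact not_mem_of_compl_mem (toSet_compl_mem_of_eval hn) h

theorem holds_iff (χ : Omega C) {D : Set (Mor C)} (hD : D ∈ BoolClosure C) :
    Holds χ D ↔ D ∈ charFilter χ := by
  constructor
  · rintro ⟨R, rfl, h⟩; exact toSet_mem_of_eval h
  · obtain ⟨R, rfl⟩ := hD
    exact fun h => ⟨R, rfl, (eval_iff_mem_charFilter χ R).2 h⟩

/-- The extension of a character can be computed with any expression. -/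
theorem holds_toSet_iff (χ : Omega C) (R : BoolExpr C) :
    Holds χ R.toSet ↔ R.eval χ.1 = true := by
  rw [holds_iff χ ⟨R, rfl⟩, eval_iff_mem_charFilter]

/-- The extension of a character restricts to the character. -/
theorem holds_idem_iff (χ : Omega C) (e : Idem C) : Holds χ e.1 ↔ χ.1 e = true := by
  rw [holds_iff χ (idem_mem_boolClosure e), mem_charFilter_iff_idem]

theorem mem_or_compl_mem (χ : Omega C) {D : Set (Mor C)} (hD : D ∈ BoolClosure C) :
    D ∈ charFilter χ ∨ Dᶜ ∈ charFilter χ := by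
  obtain ⟨R, rfl⟩ := hD
  by_cases h : R.eval χ.1 = true
  · exact .inl (toSet_mem_of_eval h)
  · exact .inr (toSet_compl_mem_of_eval h)

theorem char_ext {χ ψ : Omega C} (h : ∀ e : Idem C, Holds χ e.1 ↔ Holds ψ e.1) : χ = ψ := by
  apply Subtype.ext
  funext e
  have := h e
  rw [holds_idem_iff, holds_idem_iff] at this
  exact Bool.eq_iff_iff.2 this

/-! ### The action on characters -/

open Classical in
/-- For `s` in the enlarged hull and a character `χ` with `χ(s⁻¹ s) = 1`, the character
`s · χ : e ↦ χ(s⁻¹ e s)`. -/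
noncomputable def act (s : HullBar C) (χ : Omega C) (h : Holds χ (dom s.1)) : Omega C :=
  ⟨fun e => decide (Holds χ (conj s.1 e.1)), by
    have hB : ∀ e : Idem C, conj s.1 e.1 ∈ BoolClosure C := fun e =>
      conj_mem_boolClosure s.2 (idem_mem_boolClosure e)
    have hI : ∀ e : Idem C, Holds χ (conj s.1 e.1) ↔ conj s.1 e.1 ∈ charFilter χ := fun e =>
      holds_iff χ (hB e)
    refine ⟨?_, ?_, ?_⟩
    · rw [holds_iff χ (dom_mem_boolClosure s.2)] at h
      obtain ⟨t, D, ht, hD, hDt, hst⟩ := s.2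
      refine ⟨⟨_, idem_dom (.symm _ ht)⟩, ?_⟩
      refine decide_eq_true ((hI _).2 (Filter.mem_of_superset h ?_))
      rw [hst]
      rintro x ⟨y, hy⟩
      refine ⟨y, hy, ?_⟩
      obtain ⟨z, hz, hz'⟩ := comp_apply.1 hy
      exact ⟨z, (t.eq_some_iff).2 hz'⟩
    · intro e f
      apply Bool.eq_iff_iff.2
      have hinf : ∀ a b : Bool, (a ⊓ b) = true ↔ a = true ∧ b = true := by decide
      rw [hinf, decide_eq_true_eq, decide_eq_true_eq, decide_eq_true_eq, hI, hI, hI,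
        ← Filter.inter_mem_iff, ← conj_inter]
      rfl
    · intro n e f hf
      apply Bool.eq_iff_iff.2
      rw [sup_eq_true, decide_eq_true_eq, hI]
      simp only [decide_eq_true_eq, hI]
      rw [hf, conj_iUnion]
      constructor
      · intro hU
        by_contra! hcon
        have hc : ∀ i, (conj s.1 (e i).1)ᶜ ∈ charFilter χ := fun i =>
          (mem_or_compl_mem χ (hB (e i))).resolve_left (hcon i)
        have := Filter.iInter_mem.2 hc
        rw [← Set.compl_iUnion] at this
        exact not_mem_of_compl_mem this hU
      · rintro ⟨i, hi⟩
        exact Filter.mem_of_superset hi (Set.subset_iUnion (fun i => conj s.1 (e i).1) i)⟩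

open Classical in
/-- The extension of `s · χ` to the Boolean closure is `D ↦ χ(s⁻¹ D s)`. -/
theorem holds_act (s : HullBar C) (χ : Omega C) (h : Holds χ (dom s.1)) {D : Set (Mor C)}
    (hD : D ∈ BoolClosure C) : Holds (act s χ h) D ↔ Holds χ (conj s.1 D) := by
  have key : ∀ D : Set (Mor C), D ∈ charFilter (act s χ h) → conj s.1 D ∈ charFilter χ := by
    rintro D ⟨e, he, L, hL, hsub⟩
    have he' : conj s.1 e.1 ∈ charFilter χ :=
      (holds_iff χ (conj_mem_boolClosure s.2 (idem_mem_boolClosure e))).1 (of_decide_eq_true he)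
    have hL' : ∀ f ∈ L, (conj s.1 f.1)ᶜ ∈ charFilter χ := fun f hf => by
      have hB := conj_mem_boolClosure s.2 (idem_mem_boolClosure f)
      exact (mem_or_compl_mem χ hB).resolve_left fun hm =>
        of_decide_eq_false (hL f hf) ((holds_iff χ hB).2 hm)
    have hall : {x | ∀ f ∈ L, x ∉ conj s.1 f.1} ∈ charFilter χ := by
      clear hL hsub
      induction L with
      | nil => simp
      | cons a L ih =>
        have h1 := Filter.inter_mem (hL' a (by simp)) (ih fun f hf => hL' f (by simp [hf]))
        refine Filter.mem_of_superset h1 ?_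
        rintro x ⟨hx, hx'⟩ f hf
        rcases List.mem_cons.1 hf with rfl | hf
        · exact hx
        · exact hx' f hf
    refine Filter.mem_of_superset (Filter.inter_mem he' hall) ?_
    rintro x ⟨⟨y, hy, hye⟩, hx⟩
    exact ⟨y, hy, hsub y hye fun f hf hyf => hx f hf ⟨y, hy, hyf⟩⟩
  rw [holds_iff _ hD, holds_iff _ (conj_mem_boolClosure s.2 hD)]
  refine ⟨key D, fun hm => ?_⟩
  by_contra hn
  have h1 := key _ ((mem_or_compl_mem (act s χ h) hD).resolve_left hn)
  have h2 := Filter.inter_mem hm h1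
  rw [← conj_inter, Set.inter_compl_self] at h2
  have h3 : conj s.1 (∅ : Set (Mor C)) = ∅ := by ext x; simp [conj]
  rw [h3] at h2
  exact Filter.empty_notMem _ h2

/-! ### The transformation groupoid -/

variable (C) in
/-- Pairs `(s, χ)` with `χ(s⁻¹ s) = 1`. -/
def Pairs : Type max u v := {p : HullBar C × Omega C // Holds p.2 (dom p.1.1)}

theorem holds_inter {χ : Omega C} {D F : Set (Mor C)} (hD : D ∈ BoolClosure C)
    (hF : F ∈ BoolClosure C) : Holds χ (D ∩ F) ↔ Holds χ D ∧ Holds χ F := by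
  rw [holds_iff _ hD, holds_iff _ hF, holds_iff _ (inter_mem_boolClosure hD hF),
    Filter.inter_mem_iff]

/-- `(s, χ) ∼ (t, ψ)` iff `χ = ψ` and `s D = t D` for some idempotent `D` of the enlarged hull
with `χ(D) = 1`. -/
instance germSetoid : Setoid (Pairs C) where
  r p q := p.1.2 = q.1.2 ∧ ∃ D : Set (Mor C), idOn D ∈ HullBar C ∧ Holds p.1.2 D ∧
    comp p.1.1.1 (idOn D) = comp q.1.1.1 (idOn D)
  iseqv := by
    refine ⟨fun p => ⟨rfl, dom p.1.1.1, idOn_dom_mem p.1.1.2, p.2, rfl⟩, ?_, ?_⟩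
    · rintro p q ⟨h, D, hD, hχ, he⟩
      exact ⟨h.symm, D, hD, h ▸ hχ, he.symm⟩
    · rintro p q r ⟨h, D, hD, hχ, he⟩ ⟨h', D', hD', hχ', he'⟩
      rw [← h] at hχ'
      refine ⟨h.trans h', D ∩ D', idOn_inter_mem hD hD', (holds_inter (mem_boolClosure_of_idOn hD)
        (mem_boolClosure_of_idOn hD')).2 ⟨hχ, hχ'⟩, ?_⟩
      rw [comp_idOn_eq_iff] at he he' ⊢
      intro x hx
      rw [he x hx.1, he' x hx.2]

variable (C) in
/-- The set of germs `[s, χ]`: the arrows of the transformation groupoid. -/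
def Germ : Type max u v := Quotient (germSetoid (C := C))

/-- The germ `[s, χ]`. -/
def germ (s : HullBar C) (χ : Omega C) (h : Holds χ (dom s.1)) : Germ C :=
  Quotient.mk _ ⟨(s, χ), h⟩

theorem germ_eq_iff {s t : HullBar C} {χ ψ : Omega C} {h : Holds χ (dom s.1)}
    {k : Holds ψ (dom t.1)} : germ s χ h = germ t ψ k ↔ χ = ψ ∧ ∃ D : Set (Mor C),
      idOn D ∈ HullBar C ∧ Holds χ D ∧ ∀ x ∈ D, s.1 x = t.1 x := by
  have hq := @Quotient.eq (Pairs C) germSetoid ⟨(s, χ), h⟩ ⟨(t, ψ), k⟩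
  refine hq.trans ?_
  simp only [← comp_idOn_eq_iff]
  exact Iff.rfl

theorem germ_exists (g : Germ C) : ∃ s χ h, g = germ (C := C) s χ h := by
  obtain ⟨⟨⟨s, χ⟩, h⟩, rfl⟩ := Quotient.exists_rep g
  exact ⟨s, χ, h, rfl⟩

/-- The product in the enlarged hull. -/
def hullMul (s t : HullBar C) : HullBar C := ⟨comp s.1 t.1, comp_mem_hullBar s.2 t.2⟩

/-- The inverse in the enlarged hull. -/
def hullInv (s : HullBar C) : HullBar C := ⟨s.1.symm, symm_mem_hullBar s.2⟩

theorem holds_congr {χ : Omega C} {D F U : Set (Mor C)} (hD : D ∈ BoolClosure C)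
    (hF : F ∈ BoolClosure C) (hU : U ∈ BoolClosure C) (hχ : Holds χ U)
    (h : ∀ x ∈ U, x ∈ D ↔ x ∈ F) : Holds χ D ↔ Holds χ F := by
  rw [holds_iff _ hD, holds_iff _ hF]
  rw [holds_iff _ hU] at hχ
  exact ⟨fun h' => Filter.mem_of_superset (Filter.inter_mem hχ h') fun x hx => (h x hx.1).1 hx.2,
    fun h' => Filter.mem_of_superset (Filter.inter_mem hχ h') fun x hx => (h x hx.1).2 hx.2⟩

theorem act_congr {s t : HullBar C} {χ : Omega C} {h : Holds χ (dom s.1)}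
    {k : Holds χ (dom t.1)} {D : Set (Mor C)} (hD : idOn D ∈ HullBar C) (hχ : Holds χ D)
    (he : ∀ x ∈ D, s.1 x = t.1 x) : act s χ h = act t χ k := by
  apply char_ext
  intro e
  have hB := idem_mem_boolClosure e
  rw [holds_act _ _ _ hB, holds_act _ _ _ hB]
  refine holds_congr (conj_mem_boolClosure s.2 hB) (conj_mem_boolClosure t.2 hB)
    (mem_boolClosure_of_idOn hD) hχ fun x hx => ?_
  simp only [conj, Set.mem_ofPred_eq, he x hx]

theorem holds_dom_hullMul {s t : HullBar C} {χ : Omega C} (k : Holds χ (dom t.1)) :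
    Holds (act t χ k) (dom s.1) ↔ Holds χ (dom (hullMul s t).1) := by
  rw [holds_act _ _ _ (dom_mem_boolClosure s.2)]
  change _ ↔ Holds χ (dom (comp s.1 t.1))
  rw [dom_comp]

theorem act_hullMul {s t : HullBar C} {χ : Omega C} (k : Holds χ (dom t.1))
    (h : Holds (act t χ k) (dom s.1)) :
    act s (act t χ k) h = act (hullMul s t) χ ((holds_dom_hullMul k).1 h) := by
  apply char_ext
  intro e
  have hB := idem_mem_boolClosure e
  rw [holds_act _ _ _ hB, holds_act _ _ _ hB, holds_act _ _ _ (conj_mem_boolClosure s.2 hB)]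
  change _ ↔ Holds χ (conj (comp s.1 t.1) e.1)
  rw [conj_comp]

theorem holds_dom_hullInv {s : HullBar C} {χ : Omega C} (h : Holds χ (dom s.1)) :
    Holds (act s χ h) (dom (hullInv s).1) := by
  rw [holds_act _ _ _ (dom_mem_boolClosure (hullInv s).2)]
  change Holds χ (conj s.1 (dom s.1.symm))
  rwa [conj_dom_symm]

theorem act_of_fix {s : HullBar C} {χ : Omega C} (h : Holds χ (dom s.1))
    (hs : ∀ x ∈ dom s.1, s.1 x = some x) : act s χ h = χ := by
  apply char_ext
  intro e
  have hB := idem_mem_boolClosure e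
  rw [holds_act _ _ _ hB]
  refine holds_congr (conj_mem_boolClosure s.2 hB) hB (dom_mem_boolClosure s.2) h fun x hx => ?_
  simp [conj, hs x hx]

/-- The source map `[s, χ] ↦ χ`. -/
def germSrc : Germ C → Omega C := Quotient.lift (fun p => p.1.2) fun _ _ h => h.1

/-- The target map `[s, χ] ↦ s · χ`. -/
noncomputable def germTgt : Germ C → Omega C :=
  Quotient.lift (fun p => act p.1.1 p.1.2 p.2) (by
    rintro ⟨⟨s, χ⟩, h⟩ ⟨⟨t, ψ⟩, k⟩ ⟨hχ, D, hD, hχD, he⟩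
    dsimp only at hχ
    subst hχ
    exact act_congr hD hχD (comp_idOn_eq_iff.1 he))

@[simp] theorem germSrc_germ (s : HullBar C) (χ : Omega C) (h) : germSrc (germ s χ h) = χ := rfl

@[simp] theorem germTgt_germ (s : HullBar C) (χ : Omega C) (h) :
    germTgt (germ s χ h) = act s χ h := rfl

/-- The inversion `[s, χ] ↦ [s⁻¹, s · χ]`. -/
noncomputable def germInv : Germ C → Germ C :=
  Quotient.lift (fun p => germ (hullInv p.1.1) (act p.1.1 p.1.2 p.2) (holds_dom_hullInv p.2)) (by
    rintro ⟨⟨s, χ⟩, h⟩ ⟨⟨t, ψ⟩, k⟩ ⟨hχ, D, hD, hχD, he⟩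
    dsimp only at hχ
    subst hχ
    dsimp only at hχD he
    rw [comp_idOn_eq_iff] at he
    refine germ_eq_iff.2 ⟨act_congr hD hχD he, conj s.1.symm D,
      idOn_conj_mem (symm_mem_hullBar s.2) hD, ?_, ?_⟩
    · rw [holds_act _ _ _ (mem_boolClosure_of_idOn (idOn_conj_mem (symm_mem_hullBar s.2) hD)),
        ← conj_comp, symm_comp_self, conj_idOn_set]
      exact (holds_inter (dom_mem_boolClosure s.2) (mem_boolClosure_of_idOn hD)).2 ⟨h, hχD⟩
    · rintro x ⟨y, hy, hyD⟩
      have h1 : s.1 y = some x := (s.1.eq_some_iff).1 hy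
      have h2 : t.1 y = some x := by rw [← he y hyD]; exact h1
      exact hy.trans ((t.1.eq_some_iff).2 h2).symm)

theorem germInv_germ (s : HullBar C) (χ : Omega C) (h) :
    germInv (germ s χ h) = germ (hullInv s) (act s χ h) (holds_dom_hullInv h) := rfl

theorem germMul_aux {a b : Germ C} (h : germSrc a = germTgt b) :
    Holds b.out.1.2 (dom (hullMul a.out.1.1 b.out.1.1).1) := by
  rw [← holds_dom_hullMul b.out.2]
  have ha : germSrc a = a.out.1.2 := congrArg germSrc a.out_eq.symm
  have hb : germTgt b = act b.out.1.1 b.out.1.2 b.out.2 := 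
    congrArg germTgt b.out_eq.symm
  rw [← hb, ← h, ha]
  exact a.out.2

/-- The product of composable germs, computed on representatives; see `germMul_germ`. -/
noncomputable def germMul (a b : Germ C) (h : germSrc a = germTgt b) : Germ C :=
  germ (hullMul a.out.1.1 b.out.1.1) b.out.1.2 (germMul_aux h)

/-- The product is `[s, t · χ] [t, χ] = [s t, χ]`. -/
theorem germMul_germ (s t : HullBar C) (ψ χ : Omega C) (h : Holds ψ (dom s.1))
    (k : Holds χ (dom t.1)) (hc : germSrc (germ s ψ h) = germTgt (germ t χ k)) :
    germMul (germ s ψ h) (germ t χ k) hc = germ (hullMul s t) χ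
      ((holds_dom_hullMul k).1 ((show ψ = act t χ k from hc) ▸ h)) := by
  have hc' : ψ = act t χ k := hc
  have e1 : germ s ψ h = germ (germ s ψ h).out.1.1 (germ s ψ h).out.1.2 (germ s ψ h).out.2 :=
    (Quotient.out_eq _).symm
  have e2 : germ t χ k = germ (germ t χ k).out.1.1 (germ t χ k).out.1.2 (germ t χ k).out.2 :=
    (Quotient.out_eq _).symm
  obtain ⟨h1, D, hD, hψD, he⟩ := germ_eq_iff.1 e1
  obtain ⟨h2, F, hF, hχF, hf⟩ := germ_eq_iff.1 e2
  unfold germMul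
  have hcj := idOn_conj_mem t.2 hD
  refine Eq.symm (germ_eq_iff.2 ⟨h2, F ∩ conj t.1 D, idOn_inter_mem hF hcj, ?_, ?_⟩)
  · refine (holds_inter (mem_boolClosure_of_idOn hF) (mem_boolClosure_of_idOn hcj)).2 ⟨hχF, ?_⟩
    rw [← holds_act t χ k (mem_boolClosure_of_idOn hD), ← hc']
    exact hψD
  · rintro x ⟨hx, y, hy, hyD⟩
    have hy' := (hf x hx).symm.trans hy
    change (t.1 x).bind s.1 = ((germ t χ k).out.1.1.1 x).bind (germ s ψ h).out.1.1.1
    rw [hy, hy']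
    exact he y hyD

/-- The unit at `χ`: the germ at `χ` of any idempotent `e` with `χ(e) = 1`; see `germUnit_eq`. -/
noncomputable def germUnit (χ : Omega C) : Germ C :=
  germ ⟨idOn χ.2.1.choose.1, mem_hullBar_of_hull χ.2.1.choose.2⟩ χ (by
    rw [dom_idOn]; exact (holds_idem_iff χ _).2 χ.2.1.choose_spec)

theorem germUnit_eq {s : HullBar C} {χ : Omega C} (h : Holds χ (dom s.1))
    (hs : ∀ x ∈ dom s.1, s.1 x = some x) : germUnit χ = germ s χ h := by
  have hE : idOn χ.2.1.choose.1 ∈ HullBar C := mem_hullBar_of_hull χ.2.1.choose.2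
  refine germ_eq_iff.2 ⟨rfl, χ.2.1.choose.1 ∩ dom s.1, idOn_inter_mem hE (idOn_dom_mem s.2), ?_, ?_⟩
  · exact (holds_inter (mem_boolClosure_of_idOn hE) (dom_mem_boolClosure s.2)).2
      ⟨(holds_idem_iff χ _).2 χ.2.1.choose_spec, h⟩
  · rintro x ⟨hx, hx'⟩
    rw [hs x hx']
    exact idOn_apply.2 ⟨rfl, hx⟩

theorem idOn_fix {A : Type*} {D : Set A} : ∀ x ∈ dom (idOn D), idOn D x = some x := by
  intro x hx
  rw [dom_idOn] at hx
  exact idOn_apply.2 ⟨rfl, hx⟩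

theorem germ_congr {s t : HullBar C} {χ : Omega C} {h : Holds χ (dom s.1)}
    {k : Holds χ (dom t.1)} (he : s.1 = t.1) : germ s χ h = germ t χ k := by
  obtain rfl : s = t := Subtype.ext he
  rfl

theorem germTgt_unit (χ : Omega C) : germTgt (germUnit χ) = χ := by
  unfold germUnit
  rw [germTgt_germ]
  exact act_of_fix _ idOn_fix

/-- The groupoid structure on the germs, with unit space `Ω`. -/
noncomputable instance germGroupoid : ArrowGroupoid (Germ C) (Omega C) where
  src := germSrc
  tgt := germTgt
  unit := germUnit
  inv := germInv
  mul := germMul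
  src_unit _ := rfl
  tgt_unit := germTgt_unit
  src_inv a := by
    obtain ⟨s, χ, h, rfl⟩ := germ_exists a
    rfl
  tgt_inv a := by
    obtain ⟨s, χ, h, rfl⟩ := germ_exists a
    rw [germInv_germ, germTgt_germ, act_hullMul]
    apply act_of_fix
    change ∀ x ∈ dom (comp s.1.symm s.1), comp s.1.symm s.1 x = some x
    rw [symm_comp_self]
    exact idOn_fix
  src_mul a b h := by
    obtain ⟨s, ψ, hs, rfl⟩ := germ_exists a
    obtain ⟨t, χ, ht, rfl⟩ := germ_exists b
    rw [germMul_germ]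
    rfl
  tgt_mul a b h := by
    obtain ⟨s, ψ, hs, rfl⟩ := germ_exists a
    obtain ⟨t, χ, ht, rfl⟩ := germ_exists b
    rw [germMul_germ]
    obtain rfl : ψ = act t χ ht := h
    exact (act_hullMul ht hs).symm
  mul_assoc a b c h k := by
    obtain ⟨s, ψ, hs, rfl⟩ := germ_exists a
    obtain ⟨t, χ, ht, rfl⟩ := germ_exists b
    obtain ⟨r, φ, hr, rfl⟩ := germ_exists c
    simp only [germMul_germ]
    exact germ_congr (comp_assoc _ _ _)
  unit_mul a := by
    obtain ⟨s, χ, h, rfl⟩ := germ_exists a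
    have h1 := germUnit_eq (s := hullMul s (hullInv s)) (χ := act s χ h)
      ((holds_dom_hullMul (holds_dom_hullInv h)).1 (by
        rw [act_hullMul, act_of_fix]
        · exact h
        · change ∀ x ∈ dom (comp s.1.symm s.1), comp s.1.symm s.1 x = some x
          rw [symm_comp_self]; exact idOn_fix))
      (by
        change ∀ x ∈ dom (comp s.1 s.1.symm), comp s.1 s.1.symm x = some x
        rw [show comp s.1 s.1.symm = idOn (dom s.1.symm) from symm_comp_self s.1.symm]
        exact idOn_fix)
    simp only [germTgt_germ, h1, germMul_germ]
    refine germ_congr ?_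
    change comp (comp s.1 s.1.symm) s.1 = s.1
    rw [comp_assoc, symm_comp_self, comp_idOn_dom]
  mul_unit a := by
    obtain ⟨s, χ, h, rfl⟩ := germ_exists a
    have h1 := germUnit_eq (s := ⟨_, idOn_dom_mem s.2⟩) (χ := χ)
      (by rw [dom_idOn]; exact h) idOn_fix
    simp only [germSrc_germ, h1, germMul_germ]
    exact germ_congr (comp_idOn_dom s.1)
  inv_mul a := by
    obtain ⟨s, χ, h, rfl⟩ := germ_exists a
    simp only [germInv_germ, germMul_germ, germSrc_germ]
    refine (germUnit_eq _ ?_).symm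
    change ∀ x ∈ dom (comp s.1.symm s.1), comp s.1.symm s.1 x = some x
    rw [symm_comp_self]
    exact idOn_fix
  mul_inv a := by
    obtain ⟨s, χ, h, rfl⟩ := germ_exists a
    simp only [germInv_germ, germMul_germ, germTgt_germ]
    refine (germUnit_eq _ ?_).symm
    change ∀ x ∈ dom (comp s.1 s.1.symm), comp s.1 s.1.symm x = some x
    rw [show comp s.1 s.1.symm = idOn (dom s.1.symm) from symm_comp_self s.1.symm]
    exact idOn_fix

/-- The set of germs `[s, U] = {[s, χ] : χ ∈ U}`, for `U` in the domain of `s`. -/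
def basicSet (s : HullBar C) (U : Set (Omega C)) : Set (Germ C) :=
  {g | ∃ (χ : Omega C) (h : Holds χ (dom s.1)), χ ∈ U ∧ g = germ s χ h}

/-- The topology on the germs with basis the sets `[s, U]`, `U` open in the domain of `s`. The space
`Ω` has the topology of pointwise convergence, as a subspace of the product `{0, 1}^E`. -/
instance germTopology : TopologicalSpace (Germ C) :=
  TopologicalSpace.generateFrom {V | ∃ (s : HullBar C) (U : Set (Omega C)), IsOpen U ∧
    (∀ χ ∈ U, Holds χ (dom s.1)) ∧ V = basicSet s U}

theorem isOpen_holds {D : Set (Mor C)} (hD : D ∈ BoolClosure C) :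
    IsOpen {χ : Omega C | Holds χ D} := by
  obtain ⟨R, rfl⟩ := hD
  have hev : ∀ (e : Idem C) (b : Bool), IsOpen {χ : Omega C | χ.1 e = b} := by
    intro e b
    have hc : Continuous fun χ : Omega C => χ.1 e :=
      (continuous_apply e).comp continuous_subtype_val
    exact (isOpen_discrete ({b} : Set Bool)).preimage hc
  have : {χ : Omega C | Holds χ R.toSet} =
      ⋃ i, ({χ : Omega C | χ.1 (R.e i) = true} ∩ ⋂ j, {χ : Omega C | χ.1 (R.f i j) = false}) := by
    ext χ
    simp only [Set.mem_ofPred_eq, holds_toSet_iff, eval_eq_true, Set.mem_iUnion, Set.mem_inter_iff,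
      Set.mem_iInter]
  rw [this]
  exact isOpen_iUnion fun i => (hev _ _).inter (isOpen_iInter_of_finite fun j => hev _ _)

/-- The generating sets `[s, U]` indeed form a basis of the topology. -/
theorem isTopologicalBasis_basicSet :
    TopologicalSpace.IsTopologicalBasis {V : Set (Germ C) | ∃ (s : HullBar C) (U : Set (Omega C)),
      IsOpen U ∧ (∀ χ ∈ U, Holds χ (dom s.1)) ∧ V = basicSet s U} where
  exists_subset_inter := by
    rintro _ ⟨s, U, hU, hUs, rfl⟩ _ ⟨t, V, hV, hVt, rfl⟩ _ ⟨⟨χ, h, hχ, rfl⟩, ψ, k, hψ, he⟩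
    obtain ⟨rfl, D, hD, hχD, hst⟩ := germ_eq_iff.1 he
    have hDB := mem_boolClosure_of_idOn hD
    have hW : ∀ φ ∈ U ∩ V ∩ {φ | Holds φ D}, ∀ h : Holds φ (dom s.1), germ s φ h ∈ basicSet t V :=
      fun φ hφ h => ⟨φ, hVt φ hφ.1.2, hφ.1.2, germ_eq_iff.2 ⟨rfl, D, hD, hφ.2, hst⟩⟩
    refine ⟨basicSet s (U ∩ V ∩ {φ | Holds φ D}), ⟨s, _, (hU.inter hV).inter (isOpen_holds hDB),
      fun φ hφ => hUs φ hφ.1.1, rfl⟩, ⟨χ, h, ⟨⟨hχ, hψ⟩, hχD⟩, rfl⟩, ?_⟩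
    rintro _ ⟨φ, k', hφ, rfl⟩
    exact ⟨⟨φ, k', hφ.1.1, rfl⟩, hW φ hφ k'⟩
  sUnion_eq := by
    refine Set.eq_univ_of_forall fun g => ?_
    obtain ⟨s, χ, h, rfl⟩ := germ_exists g
    exact ⟨_, ⟨s, {χ | Holds χ (dom s.1)}, isOpen_holds (dom_mem_boolClosure s.2),
      fun _ h => h, rfl⟩, χ, h, h, rfl⟩
  eq_generateFrom := rfl

/-- Left multiplication by `c`, as a member of the enlarged hull. -/
noncomputable def mulBar (c : Mor C) : HullBar C := ⟨leftMul c, mem_hullBar_of_hull (.leftMul c)⟩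

variable (C) in
/-- The subset `C* ⋉ Ω = {[c, χ] : c an invertible arrow of C, χ(c⁻¹ c) = 1}`. -/
def unitGerms : Set (Germ C) :=
  {g | ∃ c : Mor C, IsIso c.hom ∧ ∃ (χ : Omega C) (h : Holds χ (dom (mulBar c).1)),
    g = germ (mulBar c) χ h}

end LCSC

/-!
The groupoid is étale for the reason that holds for every groupoid of germs: each `s` in the enlarged
hull gives the continuous section `χ ↦ [s, χ]` of the source map (`continuous_germ`), whose image is
open, and every germ lies on such a section. Continuity of the unit map, the inversion and the product
is checked on sections (`continuous_of_comp_germ`), the source map is open and injective on each of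
them, and the target map is the source map composed with inversion. The space `Ω` is Hausdorff and
locally compact, being locally closed in `{0, 1}^E` (`isLocallyClosed_Omega`).

The germs of invertible arrows form an open set as a union of such images, and they are closed under
the operations because left multiplication is functorial (`leftMul_comp`, `leftMul_symm_of_isIso`).

For relative topological principality it suffices to treat the evaluations `χ_c` at arrows `c`, which
are dense in `Ω`: a character `χ` comes with a proper filter of subsets of `C`, and `χ_c` tends to `χ`
as `c` runs along this filter (`denseRange_evalChar`). Suppose that `r` fixes `χ_c`. Then
`χ_{r(c)} = χ_c`, so each of `c` and `r(c)` lies in the right ideal generated by the other, and left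
cancellation gives `r(c) = c u` with `u` invertible (`exists_isIso_of_evalChar_eq`). Members of the
left inverse hull commute with right multiplication (`LeftInverseHull.map_comp`), so
`r(c y) = r(c) y = c u y`; that is, `c⁻¹ r c` is a restriction of left multiplication by `u`
(`exists_isIso_conj`). Hence the bisection of all germs of `c⁻¹` conjugates the isotropy group at `χ_c`
into the germs of invertible arrows.
-/

namespace LCSC

open PartialBij ArrowGroupoid

/-! ### The space of characters -/

section Characters

variable {C : Type u} [Category.{v} C] [LeftCancellative C]

theorem isClopen_holds {D : Set (Mor C)} (hD : D ∈ BoolClosure C) :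
    IsClopen {χ : Omega C | Holds χ D} := by
  refine ⟨?_, isOpen_holds hD⟩
  obtain ⟨R, rfl⟩ := hD
  have hev : ∀ (e : Idem C) (b : Bool), IsClosed {χ : Omega C | χ.1 e = b} := fun e b =>
    isClosed_eq ((continuous_apply e).comp continuous_subtype_val) continuous_const
  have : {χ : Omega C | Holds χ R.toSet} =
      ⋃ i, ({χ : Omega C | χ.1 (R.e i) = true} ∩ ⋂ j, {χ : Omega C | χ.1 (R.f i j) = false}) := by
    ext χ
    simp only [Set.mem_ofPred_eq, holds_toSet_iff, eval_eq_true, Set.mem_iUnion, Set.mem_inter_iff,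
      Set.mem_iInter]
  rw [this]
  exact isClosed_iUnion_of_finite fun i => (hev _ _).inter (isClosed_iInter fun j => hev _ _)

variable (C) in
/-- Inside `{0, 1}^E` the characters form the intersection of a closed set (multiplicativity and
preservation of finite unions) with an open one (being nonzero). -/
theorem isLocallyClosed_Omega : IsLocallyClosed (Omega C) := by
  have hc : ∀ e : Idem C, Continuous fun χ : Idem C → Bool => χ e := fun e => continuous_apply e
  have h2 : ∀ g : Bool × Bool → Bool, Continuous g := fun g => continuous_of_discreteTopology
  have hopen : IsOpen {χ : Idem C → Bool | ∃ e, χ e = true} := by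
    simp only [Set.ofPred_exists]
    exact isOpen_iUnion fun e => (isOpen_discrete ({true} : Set Bool)).preimage (hc e)
  have hclosed : IsClosed {χ : Idem C → Bool | (∀ e f, χ (e ⊓ f) = (χ e ⊓ χ f)) ∧
      ∀ (n : ℕ) (e : Fin n → Idem C) (f : Idem C), (f : Set (Mor C)) = ⋃ i, (e i : Set (Mor C)) →
        χ f = Finset.univ.sup fun i => χ (e i)} := by
    simp only [Set.ofPred_and, Set.ofPred_forall]
    refine IsClosed.inter (isClosed_iInter fun e => isClosed_iInter fun f => ?_)
      (isClosed_iInter fun n => isClosed_iInter fun e => isClosed_iInter fun f =>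
        isClosed_iInter fun _ => ?_)
    · exact isClosed_eq (hc _)
        ((h2 fun p => p.1 ⊓ p.2).comp ((hc e).prodMk (hc f)))
    · refine isClosed_eq (hc _) ?_
      have hs : Continuous fun b : Fin n → Bool => Finset.univ.sup b :=
        continuous_of_discreteTopology
      exact hs.comp (continuous_pi fun i => hc (e i))
  exact hopen.isLocallyClosed.inter hclosed.isLocallyClosed

theorem continuous_act (s : HullBar C) :
    Continuous fun χ : {χ : Omega C | Holds χ (dom s.1)} => act s χ.1 χ.2 := by
  refine Continuous.subtype_mk (continuous_pi fun e => ?_) _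
  have hB := isClopen_holds (conj_mem_boolClosure s.2 (idem_mem_boolClosure e))
  refine continuous_bool_rng true |>.2 ?_
  have := hB.preimage
    (continuous_subtype_val : Continuous (Subtype.val : {χ : Omega C | Holds χ (dom s.1)} → _))
  convert this using 1
  ext χ
  classical exact decide_eq_true_iff

end Characters

/-! ### The groupoid of germs is étale -/

section Etale

variable {C : Type u} [Category.{v} C] [LeftCancellative C]

theorem isOpen_basicSet (s : HullBar C) {U : Set (Omega C)} (hU : IsOpen U) :
    IsOpen (basicSet s U) := by
  have : basicSet s U = basicSet s (U ∩ {χ | Holds χ (dom s.1)}) := by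
    ext g
    constructor
    · rintro ⟨χ, h, hχ, rfl⟩; exact ⟨χ, h, ⟨hχ, h⟩, rfl⟩
    · rintro ⟨χ, h, hχ, rfl⟩; exact ⟨χ, h, hχ.1, rfl⟩
  rw [this]
  exact isTopologicalBasis_basicSet.isOpen
    ⟨s, _, hU.inter (isOpen_holds (dom_mem_boolClosure s.2)), fun χ h => h.2, rfl⟩

/-- The local section `χ ↦ [s, χ]` of the source map is continuous: two sections that agree at a
character agree on the open set of characters that take the value `1` at a suitable idempotent. -/
theorem continuous_germ (s : HullBar C) :
    Continuous fun χ : {χ : Omega C | Holds χ (dom s.1)} => germ s χ.1 χ.2 := by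
  refine continuous_generateFrom_iff.2 ?_
  rintro _ ⟨t, V, hV, hVt, rfl⟩
  have : (fun χ : {χ : Omega C | Holds χ (dom s.1)} => germ s χ.1 χ.2) ⁻¹' basicSet t V =
      Subtype.val ⁻¹' ⋃ D ∈ {D : Set (Mor C) | idOn D ∈ HullBar C ∧ ∀ x ∈ D, s.1 x = t.1 x},
        V ∩ {χ | Holds χ D} := by
    ext ⟨χ, h⟩
    simp only [Set.mem_preimage, Set.mem_iUnion, Set.mem_inter_iff, Set.mem_ofPred_eq]
    constructor
    · rintro ⟨ψ, k, hψ, he⟩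
      obtain ⟨rfl, D, hD, hχD, hst⟩ := germ_eq_iff.1 he
      exact ⟨D, ⟨hD, hst⟩, hψ, hχD⟩
    · rintro ⟨D, ⟨hD, hst⟩, hχ, hχD⟩
      exact ⟨χ, hVt χ hχ, hχ, germ_eq_iff.2 ⟨rfl, D, hD, hχD, hst⟩⟩
  rw [this]
  exact (isOpen_biUnion fun D hD =>
    hV.inter (isOpen_holds (mem_boolClosure_of_idOn hD.1))).preimage continuous_subtype_val

theorem continuous_of_comp_germ {Y : Type*} [TopologicalSpace Y] {f : Germ C → Y}
    (hf : ∀ s : HullBar C,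
      Continuous fun χ : {χ : Omega C | Holds χ (dom s.1)} => f (germ s χ.1 χ.2)) :
    Continuous f := by
  refine continuous_def.2 fun W hW => isOpen_iff_forall_mem_open.2 fun g hg => ?_
  obtain ⟨s, χ, h, rfl⟩ := germ_exists g
  refine ⟨basicSet s (Subtype.val '' ((fun χ : {χ : Omega C | Holds χ (dom s.1)} =>
    f (germ s χ.1 χ.2)) ⁻¹' W)), ?_, isOpen_basicSet s ?_, χ, h, ⟨⟨χ, h⟩, hg, rfl⟩, rfl⟩
  · rintro _ ⟨ψ, k, ⟨⟨_, k'⟩, hψ, rfl⟩, rfl⟩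
    exact hψ
  · exact (isOpen_holds (dom_mem_boolClosure s.2)).isOpenMap_subtype_val _ (hW.preimage (hf s))

theorem continuous_germSrc : Continuous (germSrc : Germ C → Omega C) :=
  continuous_of_comp_germ fun _ => continuous_subtype_val

theorem continuous_germInv : Continuous (germInv : Germ C → Germ C) :=
  continuous_of_comp_germ fun s => (continuous_germ (hullInv s)).comp
    ((continuous_act s).subtype_mk fun χ => holds_dom_hullInv χ.2)

theorem germInv_germInv (g : Germ C) : germInv (germInv g) = g := by
  obtain ⟨s, χ, h, rfl⟩ := germ_exists g
  rw [germInv_germ, germInv_germ]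
  exact germ_eq_iff.2 ⟨tgt_inv (germ s χ h), dom s.1, idOn_dom_mem s.2, by
    rw [show act _ _ _ = χ from tgt_inv (germ s χ h)]; exact h, fun _ _ => rfl⟩

variable (C) in
/-- Inversion as a homeomorphism. -/
noncomputable def germInvHomeomorph : Germ C ≃ₜ Germ C where
  toFun := germInv
  invFun := germInv
  left_inv := germInv_germInv
  right_inv := germInv_germInv
  continuous_toFun := continuous_germInv
  continuous_invFun := continuous_germInv

theorem germTgt_eq_comp : (germTgt : Germ C → Omega C) = germSrc ∘ germInvHomeomorph C := by
  funext g
  exact (src_inv g).symm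

theorem continuous_germTgt : Continuous (germTgt : Germ C → Omega C) := by
  rw [germTgt_eq_comp]
  exact continuous_germSrc.comp (germInvHomeomorph C).continuous

theorem isOpenMap_germSrc : IsOpenMap (germSrc : Germ C → Omega C) := by
  refine isTopologicalBasis_basicSet.isOpenMap_iff.2 ?_
  rintro _ ⟨s, U, hU, hUs, rfl⟩
  convert hU
  ext χ
  constructor
  · rintro ⟨_, ⟨ψ, k, hψ, rfl⟩, rfl⟩; exact hψ
  · intro hχ; exact ⟨_, ⟨χ, hUs χ hχ, hχ, rfl⟩, rfl⟩

theorem isOpenMap_germTgt : IsOpenMap (germTgt : Germ C → Omega C) := by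
  rw [germTgt_eq_comp]
  exact isOpenMap_germSrc.comp (germInvHomeomorph C).isOpenMap

theorem injOn_germSrc (s : HullBar C) : Set.InjOn germSrc (basicSet s Set.univ) := by
  rintro _ ⟨χ, h, -, rfl⟩ _ ⟨ψ, k, -, rfl⟩ he
  obtain rfl : χ = ψ := he
  rfl

theorem injOn_germTgt (s : HullBar C) : Set.InjOn germTgt (basicSet s Set.univ) := by
  rw [germTgt_eq_comp]
  refine (injOn_germSrc (hullInv s)).comp (germInvHomeomorph C).injective.injOn ?_
  rintro _ ⟨χ, h, -, rfl⟩
  exact ⟨_, _, trivial, germInv_germ s χ h⟩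

theorem isOpenEmbedding_domRestrict {X Y : Type*} [TopologicalSpace X] [TopologicalSpace Y]
    {f : X → Y} (hc : Continuous f) (ho : IsOpenMap f) {U : Set X} (hU : IsOpen U)
    (hi : U.InjOn f) : IsOpenEmbedding (U.domRestrict f) :=
  .of_continuous_injective_isOpenMap (hc.comp continuous_subtype_val)
    (Set.injOn_iff_injective.1 hi) (ho.domRestrict hU)

theorem isOpenEmbedding_germSrc (s : HullBar C) :
    IsOpenEmbedding ((basicSet s Set.univ).domRestrict germSrc) :=
  isOpenEmbedding_domRestrict continuous_germSrc isOpenMap_germSrc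
    (isOpen_basicSet s isOpen_univ) (injOn_germSrc s)

theorem isOpenEmbedding_germTgt (s : HullBar C) :
    IsOpenEmbedding ((basicSet s Set.univ).domRestrict germTgt) :=
  isOpenEmbedding_domRestrict continuous_germTgt isOpenMap_germTgt
    (isOpen_basicSet s isOpen_univ) (injOn_germTgt s)

theorem isOpenBisection_basicSet (s : HullBar C) : IsOpenBisection (basicSet s Set.univ) :=
  ⟨isOpen_basicSet s isOpen_univ, (isOpenEmbedding_germSrc s).isEmbedding,
    (isOpenEmbedding_germTgt s).isEmbedding⟩

theorem exists_basicSet_mem_nhds (g : Germ C) : ∃ s : HullBar C, basicSet s Set.univ ∈ 𝓝 g := by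
  obtain ⟨s, χ, h, rfl⟩ := germ_exists g
  exact ⟨s, (isOpen_basicSet s isOpen_univ).mem_nhds ⟨χ, h, trivial, rfl⟩⟩

theorem continuous_germUnit : Continuous (germUnit : Omega C → Germ C) := by
  refine continuous_iff_continuousAt.2 fun χ => ?_
  obtain ⟨e, he⟩ := χ.2.1
  -- Near `χ` the unit map is the section given by the idempotent `e`.
  let s : HullBar C := ⟨idOn e.1, mem_hullBar_of_hull e.2⟩
  have hχ : Holds χ (dom s.1) := by
    rw [show dom s.1 = e.1 from dom_idOn _]; exact (holds_idem_iff χ e).2 he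
  have hc : ContinuousOn (germUnit : Omega C → Germ C) {χ | Holds χ (dom s.1)} := by
    refine continuousOn_iff_continuous_domRestrict.2 ((continuous_germ s).congr fun ψ => ?_)
    exact (germUnit_eq ψ.2 idOn_fix).symm
  exact hc.continuousAt ((isOpen_holds (dom_mem_boolClosure s.2)).mem_nhds hχ)

theorem continuous_germMul : Continuous
    fun p : {p : Germ C × Germ C // germSrc p.1 = germTgt p.2} => germMul p.1.1 p.1.2 p.2 := by
  refine continuous_iff_continuousAt.2 fun p => ?_
  obtain ⟨s, hs⟩ := exists_basicSet_mem_nhds p.1.1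
  obtain ⟨t, ht⟩ := exists_basicSet_mem_nhds p.1.2
  -- Near `p` the product depends on the source of the second factor only, through the section
  -- given by `s t`.
  let O : Set {p : Germ C × Germ C // germSrc p.1 = germTgt p.2} :=
    {p | p.1.1 ∈ basicSet s Set.univ ∧ p.1.2 ∈ basicSet t Set.univ}
  have hO : O ∈ 𝓝 p :=
    Filter.inter_mem ((continuous_fst.comp continuous_subtype_val).continuousAt hs)
      ((continuous_snd.comp continuous_subtype_val).continuousAt ht)
  have key : ∀ q ∈ O, ∃ h, germMul q.1.1 q.1.2 q.2 = germ (hullMul s t) (germSrc q.1.2) h := by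
    rintro ⟨⟨a, b⟩, hab⟩ ⟨⟨ψ, h, -, ha⟩, χ, k, -, hb⟩
    dsimp only at ha hb
    subst ha hb
    exact ⟨_, germMul_germ s t ψ χ h k hab⟩
  choose h key using key
  have hc : ContinuousOn (fun p : {p : Germ C × Germ C // germSrc p.1 = germTgt p.2} =>
      germMul p.1.1 p.1.2 p.2) O := by
    refine continuousOn_iff_continuous_domRestrict.2 (Continuous.congr
      ((continuous_germ (hullMul s t)).comp (Continuous.subtype_mk (f := fun q : O =>
        germSrc q.1.1.2) ?_ fun q => h q.1 q.2)) fun q => (key q.1 q.2).symm)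
    exact continuous_germSrc.comp (continuous_snd.comp
      (continuous_subtype_val.comp continuous_subtype_val))
  exact hc.continuousAt hO

variable (C) in
theorem isEtale_germ : IsEtale (Germ C) where
  t2 := inferInstanceAs (T2Space (Omega C))
  locallyCompact := (isLocallyClosed_Omega C).locallyCompactSpace
  continuous_unit := continuous_germUnit
  continuous_inv := continuous_germInv
  continuous_mul := continuous_germMul
  src_local_homeo := isLocalHomeomorph_iff_isOpenEmbedding_restrict.2 fun g =>
    (exists_basicSet_mem_nhds g).elim fun s hs => ⟨_, hs, isOpenEmbedding_germSrc s⟩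
  tgt_local_homeo := isLocalHomeomorph_iff_isOpenEmbedding_restrict.2 fun g =>
    (exists_basicSet_mem_nhds g).elim fun s hs => ⟨_, hs, isOpenEmbedding_germTgt s⟩

end Etale

/-! ### Left multiplication maps and the left inverse hull -/

section Multiplication

variable {C : Type u} [Category.{v} C] [LeftCancellative C]

theorem leftMul_mk {a b d : C} (g : b ⟶ d) (f : a ⟶ b) :
    leftMul (C := C) ⟨b, d, g⟩ ⟨a, b, f⟩ = some ⟨a, d, f ≫ g⟩ := by
  change mulOpt _ _ = _
  simp [mulOpt]

theorem leftMul_eq_some {b d : C} {g : b ⟶ d} {x y : Mor C} :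
    leftMul (C := C) ⟨b, d, g⟩ x = some y ↔
      ∃ (a : C) (f : a ⟶ b), x = ⟨a, b, f⟩ ∧ y = ⟨a, d, f ≫ g⟩ := by
  constructor
  · intro h
    obtain ⟨a, b', f⟩ := x
    by_cases hb : b' = b
    · subst hb
      rw [leftMul_mk, Option.some.injEq] at h
      exact ⟨a, f, rfl, h.symm⟩
    · change mulOpt _ _ = _ at h
      simp [mulOpt, hb] at h
  · rintro ⟨a, f, rfl, rfl⟩
    exact leftMul_mk g f

theorem leftMul_comp {a b d : C} (g : b ⟶ d) (f : a ⟶ b) :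
    comp (leftMul (C := C) ⟨b, d, g⟩) (leftMul ⟨a, b, f⟩) = leftMul ⟨a, d, f ≫ g⟩ := by
  apply ext_some
  intro x z
  simp only [comp_apply, leftMul_eq_some]
  constructor
  · rintro ⟨_, ⟨w, k, rfl, rfl⟩, w', k', h, rfl⟩
    cases h
    exact ⟨w, k, rfl, by simp⟩
  · rintro ⟨w, k, rfl, rfl⟩
    exact ⟨_, ⟨w, k, rfl, rfl⟩, w, _, rfl, by simp⟩

theorem leftMul_symm_of_isIso {a b : C} (f : a ⟶ b) [IsIso f] :
    (leftMul (C := C) ⟨a, b, f⟩).symm = leftMul ⟨b, a, inv f⟩ := by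
  apply ext_some
  intro x y
  rw [PEquiv.eq_some_iff, leftMul_eq_some, leftMul_eq_some]
  constructor
  · rintro ⟨w, k, rfl, rfl⟩; exact ⟨w, _, rfl, by simp⟩
  · rintro ⟨w, k, rfl, rfl⟩; exact ⟨w, _, rfl, by simp⟩

variable (C) in
/-- The right ideal `c C` of arrows that factor through `c` is an idempotent of the hull. -/
def rightIdeal (c : Mor C) : Idem C := ⟨dom (leftMul c).symm, idem_dom (.symm _ (.leftMul c))⟩

theorem mem_rightIdeal {b d : C} {g : b ⟶ d} {y : Mor C} :
    y ∈ (rightIdeal C ⟨b, d, g⟩).1 ↔ ∃ (a : C) (f : a ⟶ b), y = ⟨a, d, f ≫ g⟩ := by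
  simp only [rightIdeal, dom, Set.mem_ofPred_eq, PEquiv.eq_some_iff, leftMul_eq_some]
  constructor
  · rintro ⟨_, a, f, -, h⟩; exact ⟨a, f, h⟩
  · rintro ⟨a, f, h⟩; exact ⟨_, a, f, rfl, h⟩

/-- Members of the left inverse hull commute with right multiplication: `s (f k) = s(f) k`. -/
theorem LeftInverseHull.map_comp {s : Mor C ≃. Mor C} (hs : LeftInverseHull C s) :
    ∀ {a b : C} {f : a ⟶ b} {y : Mor C}, s ⟨a, b, f⟩ = some y →
      ∃ (d : C) (g : a ⟶ d), y = ⟨a, d, g⟩ ∧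
        ∀ (w : C) (k : w ⟶ a), s ⟨w, b, k ≫ f⟩ = some ⟨w, d, k ≫ g⟩ := by
  induction hs with
  | leftMul c =>
    intro a b f y h
    obtain ⟨c, d, g⟩ := c
    obtain ⟨a', f', hx, rfl⟩ := leftMul_eq_some.1 h
    cases hx
    exact ⟨d, f ≫ g, rfl, fun w k => by rw [leftMul_mk, Category.assoc]⟩
  | symm s _ ih =>
    intro a b f y h
    rw [PEquiv.eq_some_iff] at h
    obtain ⟨a', d, g⟩ := y
    obtain ⟨d', g', hx, hk⟩ := ih h
    cases hx
    exact ⟨d, g, rfl, fun w k => s.eq_some_iff.2 (hk w k)⟩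
  | comp s t _ _ ihs iht =>
    intro a b f y h
    obtain ⟨z, hz, hy⟩ := comp_apply.1 h
    obtain ⟨d, g, rfl, hk⟩ := iht hz
    obtain ⟨d', g', rfl, hk'⟩ := ihs hy
    exact ⟨d', g', rfl, fun w k => comp_apply.2 ⟨_, hk w k, hk' w k⟩⟩

theorem exists_hull_extending {r : Mor C ≃. Mor C} (hr : r ∈ HullBar C) :
    ∃ s, LeftInverseHull C s ∧ ∀ x y, r x = some y → s x = some y := by
  obtain ⟨s, D, hs, -, -, rfl⟩ := hr
  refine ⟨s, hs, fun x y h => ?_⟩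
  obtain ⟨z, hz, hy⟩ := comp_apply.1 h
  rwa [(idOn_apply.1 hz).1] at hy

end Multiplication

/-! ### The subgroupoid of germs of invertible arrows -/

section UnitGerms

variable {C : Type u} [Category.{v} C] [LeftCancellative C]

theorem germ_eq_of_le {s t : HullBar C}
    {χ : Omega C} (h : Holds χ (dom s.1)) (hst : ∀ x y, s.1 x = some y → t.1 x = some y) :
    ∃ k : Holds χ (dom t.1), germ s χ h = germ t χ k := by
  refine ⟨(holds_iff _ (dom_mem_boolClosure t.2)).2 (Filter.mem_of_superset
    ((holds_iff _ (dom_mem_boolClosure s.2)).1 h) fun x ⟨y, hy⟩ => ⟨y, hst x y hy⟩),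
    germ_eq_iff.2 ⟨rfl, dom s.1, idOn_dom_mem s.2, h, fun x ⟨y, hy⟩ => ?_⟩⟩
  rw [hy, hst x y hy]

theorem exists_germMul_eq {s t : HullBar C}
    {ψ χ : Omega C} {h : Holds ψ (dom s.1)} {k : Holds χ (dom t.1)} {a b : Germ C}
    (hc : germSrc a = germTgt b) (ha : a = germ s ψ h) (hb : b = germ t χ k) :
    ∃ m, germMul a b hc = germ (hullMul s t) χ m := by
  subst ha hb
  exact ⟨_, germMul_germ s t ψ χ h k hc⟩

theorem Holds.nonempty {χ : Omega C} {D : Set (Mor C)} (h : Holds χ D) : D.Nonempty := by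
  obtain ⟨R, rfl, hR⟩ := h
  exact Filter.nonempty_of_mem (toSet_mem_of_eval hR)

variable (C) in
theorem isOpenSubgroupoid_unitGerms : IsOpenSubgroupoid (unitGerms C) where
  inv_mem := by
    rintro _ ⟨⟨a, b, f⟩, hf, χ, h, rfl⟩
    dsimp only at hf
    have he : (hullInv (mulBar (C := C) ⟨a, b, f⟩)) = mulBar ⟨b, a, CategoryTheory.inv f⟩ :=
      Subtype.ext (leftMul_symm_of_isIso f)
    refine ⟨⟨b, a, CategoryTheory.inv f⟩, inferInstanceAs (IsIso (CategoryTheory.inv f)), _,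
      he ▸ holds_dom_hullInv h, ?_⟩
    exact (germInv_germ _ _ _).trans (germ_congr (congrArg Subtype.val he))
  mul_mem := by
    rintro _ ⟨⟨b, d, g⟩, hg, ψ, h, rfl⟩ _ ⟨⟨a, b', f⟩, hf, χ, k, rfl⟩ hc
    dsimp only at hg hf
    have hd := (holds_dom_hullMul k).1 ((show ψ = act _ χ k from hc) ▸ h)
    -- The character takes the value `1` at the domain of the product, so this domain is nonempty,
    -- and the two arrows are composable.
    obtain rfl : b' = b := by
      obtain ⟨x, z, hx⟩ := hd.nonempty
      obtain ⟨y, hy, hz⟩ := comp_apply.1 hx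
      obtain ⟨w, l, rfl, rfl⟩ := leftMul_eq_some.1 hy
      obtain ⟨w', l', hw, -⟩ := leftMul_eq_some.1 hz
      exact (Mor.mk.inj hw).2.1
    have he : hullMul (mulBar (C := C) ⟨b', d, g⟩) (mulBar ⟨a, b', f⟩) = mulBar ⟨a, d, f ≫ g⟩ :=
      Subtype.ext (leftMul_comp g f)
    refine ⟨⟨a, d, f ≫ g⟩, inferInstanceAs (IsIso (f ≫ g)), χ, he ▸ hd, ?_⟩
    exact (germMul_germ _ _ _ _ h k hc).trans (germ_congr (congrArg Subtype.val he))
  isOpen := by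
    have : unitGerms C = ⋃ c ∈ {c : Mor C | IsIso c.hom}, basicSet (mulBar c) Set.univ := by
      ext g
      simp only [Set.mem_iUnion]
      constructor
      · rintro ⟨c, hc, χ, h, rfl⟩; exact ⟨c, hc, χ, h, trivial, rfl⟩
      · rintro ⟨c, hc, χ, h, -, rfl⟩; exact ⟨c, hc, χ, h, rfl⟩
    rw [this]
    exact isOpen_biUnion fun c _ => isOpen_basicSet _ isOpen_univ

end UnitGerms

/-! ### Point evaluations and their isotropy -/

section PointEvaluations

variable {C : Type u} [Category.{v} C] [LeftCancellative C]

open Classical in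
/-- The character of evaluation at an arrow `c`, with value `1` at `e` exactly when `c ∈ e`. -/
noncomputable def evalChar (c : Mor C) : Omega C :=
  ⟨fun e => decide (c ∈ e.1), ⟨⟨_, idem_dom (.leftMul ⟨c.tgt, c.tgt, 𝟙 _⟩)⟩,
      decide_eq_true ⟨_, leftMul_mk _ c.hom⟩⟩,
    fun e f => by
      apply Bool.eq_iff_iff.2
      have hinf : ∀ a b : Bool, (a ⊓ b) = true ↔ a = true ∧ b = true := by decide
      rw [hinf, decide_eq_true_eq, decide_eq_true_eq, decide_eq_true_eq]
      exact Iff.rfl,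
    fun n e f hf => by
      apply Bool.eq_iff_iff.2
      rw [sup_eq_true, decide_eq_true_eq, hf, Set.mem_iUnion]
      simp only [decide_eq_true_eq]⟩

theorem evalChar_eq_true {c : Mor C} {e : Idem C} : (evalChar c).1 e = true ↔ c ∈ e.1 := by
  classical exact decide_eq_true_iff

theorem holds_evalChar {c : Mor C} {D : Set (Mor C)} (hD : D ∈ BoolClosure C) :
    Holds (evalChar c) D ↔ c ∈ D := by
  obtain ⟨R, rfl⟩ := hD
  rw [holds_toSet_iff, eval_eq_true]
  simp only [evalChar_eq_true, ← Bool.not_eq_true, BoolExpr.toSet, Set.mem_iUnion, Set.mem_sdiff,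
    not_exists]

theorem act_evalChar {s : HullBar C} {c d : Mor C} (hs : s.1 c = some d)
    (h : Holds (evalChar c) (dom s.1)) : act s (evalChar c) h = evalChar d := by
  apply char_ext
  intro e
  have hB := idem_mem_boolClosure e
  rw [holds_act _ _ _ hB, holds_evalChar hB, holds_evalChar (conj_mem_boolClosure s.2 hB)]
  simp [conj, hs]

variable (C) in
/-- A character is the limit of the point evaluations along its filter of sets of arrows. -/
theorem denseRange_evalChar : DenseRange (evalChar : Mor C → Omega C) := by
  intro χ
  refine mem_closure_of_tendsto (f := evalChar) (b := charFilter χ) ?_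
    (Filter.Eventually.of_forall fun c => ⟨c, rfl⟩)
  refine tendsto_subtype_rng.2 (tendsto_pi_nhds.2 fun e => ?_)
  refine tendsto_nhds_of_eventually_eq ?_
  cases h : χ.1 e with
  | true => exact Filter.mem_of_superset (idem_mem_charFilter h) fun c hc => evalChar_eq_true.2 hc
  | false =>
    exact Filter.mem_of_superset (idem_compl_mem_charFilter h) fun c hc =>
      Bool.eq_false_iff.2 fun h' => hc (evalChar_eq_true.1 h')

/-- The ideals `f C` and `g C` already distinguish the evaluations at `f` and at `g`, unless these
arrows differ by an invertible arrow on the right. -/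
theorem exists_isIso_of_evalChar_eq {a b d : C} {f : a ⟶ b} {g : a ⟶ d}
    (h : evalChar (C := C) ⟨a, d, g⟩ = evalChar ⟨a, b, f⟩) :
    ∃ u : a ⟶ a, IsIso u ∧ (⟨a, d, g⟩ : Mor C) = ⟨a, b, u ≫ f⟩ := by
  have hmem : ∀ e : Idem C, ⟨a, d, g⟩ ∈ e.1 ↔ ⟨a, b, f⟩ ∈ e.1 := fun e => by
    rw [← evalChar_eq_true, h, evalChar_eq_true]
  obtain ⟨a', u, hu⟩ := mem_rightIdeal.1
    ((hmem (rightIdeal C ⟨a, b, f⟩)).2 (mem_rightIdeal.2 ⟨a, 𝟙 a, by simp⟩))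
  obtain ⟨a'', v, hv⟩ := mem_rightIdeal.1
    ((hmem (rightIdeal C ⟨a, d, g⟩)).1 (mem_rightIdeal.2 ⟨a, 𝟙 a, by simp⟩))
  cases hu
  simp only [Mor.mk.injEq] at hv
  obtain ⟨rfl, -, hv⟩ := hv
  have hv := eq_of_heq hv
  have hvu : v ≫ u = 𝟙 a := LeftCancellative.cancel f _ _ (by
    rw [Category.id_comp, Category.assoc]; exact hv.symm)
  have huv : u ≫ v = 𝟙 a := LeftCancellative.cancel (u ≫ f) _ _ (by
    rw [Category.id_comp, Category.assoc, ← hv])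
  exact ⟨u, ⟨v, huv, hvu⟩, rfl⟩

/-- If `r` fixes the evaluation at `c`, then `r(c) = c u` with `u` invertible, and `c⁻¹ r c` is left
multiplication by `u` wherever it is defined. -/
theorem exists_isIso_conj {a b : C} (f : a ⟶ b) {r : HullBar C}
    (h : Holds (evalChar (C := C) ⟨a, b, f⟩) (dom r.1))
    (hr : act r (evalChar ⟨a, b, f⟩) h = evalChar ⟨a, b, f⟩) :
    ∃ u : a ⟶ a, IsIso u ∧ ∀ y z,
      comp (comp (leftMul ⟨a, b, f⟩).symm r.1) (leftMul ⟨a, b, f⟩) y = some z →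
        leftMul ⟨a, a, u⟩ y = some z := by
  obtain ⟨c, hc⟩ := (holds_evalChar (dom_mem_boolClosure r.2)).1 h
  obtain ⟨s, hs, hrs⟩ := exists_hull_extending r.2
  obtain ⟨d, g, rfl, hk⟩ := hs.map_comp (hrs _ _ hc)
  rw [act_evalChar hc] at hr
  obtain ⟨u, hu, hg⟩ := exists_isIso_of_evalChar_eq hr
  cases hg
  refine ⟨u, hu, fun y z hz => ?_⟩
  obtain ⟨x, hy, hx⟩ := comp_apply.1 hz
  obtain ⟨x', hx, hx'⟩ := comp_apply.1 hx
  obtain ⟨w, k, rfl, rfl⟩ := leftMul_eq_some.1 hy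
  have h1 := hrs _ _ hx
  rw [hk, Option.some.injEq] at h1
  rw [leftMul_mk]
  rw [PEquiv.eq_some_iff] at hx'
  subst h1
  exact congrArg some (mulOpt_inj (leftMul_mk f (k ≫ u))
    (by rw [Category.assoc]; exact hx'))

theorem evalChar_mem_constrainedUnits (c : Mor C) :
    evalChar c ∈ constrainedUnits (G := Germ C) {unitGerms C} := by
  obtain ⟨a, b, f⟩ := c
  -- The bisection of all germs of `c⁻¹`.
  let s : HullBar C := hullInv (mulBar ⟨a, b, f⟩)
  have hs1 : s.1 ⟨a, b, f⟩ = some ⟨a, a, 𝟙 a⟩ := by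
    refine (leftMul _).eq_some_iff.2 ?_
    rw [leftMul_mk, Category.id_comp]
  have hs : Holds (evalChar ⟨a, b, f⟩) (dom s.1) :=
    (holds_evalChar (dom_mem_boolClosure s.2)).2 ⟨_, hs1⟩
  refine ⟨basicSet s Set.univ, isOpenBisection_basicSet s, _, rfl, ?_, ?_⟩
  · have hγ : germ s _ hs ∈ basicSet s Set.univ := ⟨_, hs, trivial, rfl⟩
    exact ⟨_, ⟨_, hγ, rfl⟩, _, hγ, src_inv _, (inv_mul (germ s _ hs)).symm⟩
  · rintro _ ⟨_, ⟨_, ⟨χ, k, -, rfl⟩, g, ⟨hg, hg'⟩, hc, rfl⟩, _, ⟨_, ⟨ψ, l, -, rfl⟩, rfl⟩, hc', rfl⟩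
    obtain ⟨r, φ, hr, rfl⟩ := germ_exists g
    obtain rfl : φ = evalChar ⟨a, b, f⟩ := hg
    obtain rfl : χ = evalChar ⟨a, b, f⟩ := hc.trans hg'
    obtain rfl : ψ = evalChar ⟨a, b, f⟩ := by
      rw [src_mul, tgt_inv] at hc'
      exact hc'.symm
    obtain ⟨u, hu, hconj⟩ := exists_isIso_conj f hr hg'
    obtain ⟨_, h1⟩ := exists_germMul_eq hc rfl rfl
    obtain ⟨m, hm⟩ := exists_germMul_eq hc' h1 (germInv_germ _ _ l)
    obtain ⟨n, hn⟩ := germ_eq_of_le (t := mulBar ⟨a, a, u⟩) m hconj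
    exact ⟨⟨a, a, u⟩, hu, _, n, hm.trans hn⟩

end PointEvaluations

end LCSC

theorem mainTheorem3 (C : Type u) [Category.{v} C] [LCSC.LeftCancellative C] :
    ArrowGroupoid.IsEtale (LCSC.Germ C) ∧
    ArrowGroupoid.IsOpenSubgroupoid (LCSC.unitGerms C) ∧
    ArrowGroupoid.IsTopPrincipalRelTo (G := LCSC.Germ C) {LCSC.unitGerms C} := by
  refine ⟨LCSC.isEtale_germ C, LCSC.isOpenSubgroupoid_unitGerms C, ?_⟩
  exact (LCSC.denseRange_evalChar C).mono
    (Set.range_subset_iff.2 LCSC.evalChar_mem_constrainedUnits)
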